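/- Let $\mathbb C_q=\mathbb C[q,q^{-1}]$ with $q$ an indeterminate. Put $p(1)=\dots=p(4)=0$, $p(5)=1$ and $\pi_{ij}=p(i)+p(j) \bmod 2$. Let $\mathcal O(\mathrm{SL}_q(4|1))$ be the $\mathbb C_q$-superalgebra generated by $a_{ij}$ ($1\le i,j\le 5$, of parity $\pi_{ij}$) and by even elements $D_1^{-1},D_2^{-1}$, subject to $a_{ij}^2=0$ when $\pi_{ij}=1$; Manin's relations $$a_{ij}a_{il}=(-1)^{\pi_{ij}\pi_{il}}q^{(-1)^{p(i)+1}}a_{il}a_{ij}\ (j<l),\qquad a_{ij}a_{kj}=(-1)^{\pi_{ij}\pi_{kj}}q^{(-1)^{p(j)+1}}a_{kj}a_{ij}\ (i<k),$$ $$a_{ij}a_{kl}=(-1)^{\pi_{ij}\pi_{kl}}a_{kl}a_{ij}\quad (i<k,\ j>l\ \text{ or }\ i>k,\ j<l),$$ $$a_{ij}a_{kl}-(-1)^{\pi_{ij}\pi_{kl}}a_{kl}a_{ij}=(-1)^{\pi_{ij}\pi_{kj}}(q^{-1}-q)\,a_{kj}a_{il}\quad (i<k,\ j<l);$$ the relations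 that make $D_1^{-1}$ and $D_2^{-1}$ two-sided inverses of $D_1=\det_q(a_{ij})_{1\le i,j\le4}$ and $D_2=a_{55}$; and $\mathrm{Ber}_q=1$. Here $\det_q(b)=\sum_{\sigma\in S_4}(-q)^{-\ell(\sigma)}b_{1\sigma(1)}\cdots b_{4\sigma(4)}$ and $\mathrm{Ber}_q=\det_q\big(a_{ij}-a_{i5}D_2^{-1}a_{5j}\big)_{1\le i,j\le 4}\,D_2^{-1}$. Let $\mathcal O(P_{l,q})$ be the quotient of $\mathcal O(\mathrm{SL}_q(4|1))$ by the two-sided ideal generated by the $a_{ij}$ with $i\in\{1,2\}$, $j\in\{3,4,5\}$. Write $x=(a_{ij})_{i,j\in\{1,2\}}$ for the upper left block over $\mathcal O(P_{l,q})$. **Proposition.** The matrix $x$ is invertible over $\mathcal O(P_{l,q})$, so that a $2\times 2$ matrix $t=(t_{ij})_{i=3,4;\,j=1,2}$ and a row $\tilde\tau=(\tilde\tau_{51},\tilde\tau_{52})$ are defined by $$t\,x=(a_{ij})_{i=3,4;\,j=1,2},\qquad \tilde\tau\,x=(a_{51},a_{52}).$$ Let the quantum big cell $\mathcal O_q(U_{12})$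 be the $\mathbb C_q$-subalgebra of $\mathcal O(P_{l,q})$ generated by the $t_{ij}$ and the $\tilde\tau_{5j}$. Then, as a superalgebra, $\mathcal O_q(U_{12})$ has the presentation $$\mathcal O_q(U_{12})\cong \mathbb C_q\langle t_{ij},\tilde\tau_{5j}\;:\;i=3,4,\ j=1,2\rangle/I_U ,$$ with $t_{ij}$ even and $\tilde\tau_{5j}$ odd, the isomorphism sending generators to the elements of the same name, where $I_U$ is the two-sided ideal generated by the relations (for $i=3,4$ and $j=1,2$) $$t_{i1}t_{i2}=q\,t_{i2}t_{i1},\qquad t_{3j}t_{4j}=q^{-1}t_{4j}t_{3j},$$ $$t_{31}t_{42}=t_{42}t_{31},\qquad t_{32}t_{41}=t_{41}t_{32}+(q^{-1}-q)\,t_{42}t_{31},$$ $$\tilde\tau_{51}\tilde\tau_{52}=-q^{-1}\tilde\tau_{52}\tilde\tau_{51},\qquad t_{ij}\tilde\tau_{5j}=q^{-1}\tilde\tau_{5j}t_{ij},$$ $$t_{i1}\tilde\tau_{52}=\tilde\tau_{52}t_{i1},\qquad t_{i2}\tilde\tau_{51}=\tilde\tau_{51}t_{i2}+(q^{-1}-q)\,t_{i1}\tilde\tau_{52},\qquad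 \tilde\tau_{5j}^2=0 .$$ -/

import Mathlib

noncomputable section

namespace QuantumBigCell

/-- The ground ring `C_q = ℂ[q, q⁻¹]`, with `q` an indeterminate. -/
abbrev Cq : Type := LaurentPolynomial ℂ

/-- The indeterminate `q`. -/
def q : Cq := LaurentPolynomial.T 1

/-- The inverse `q⁻¹` of the indeterminate. -/
def qInv : Cq := LaurentPolynomial.T (-1)

/-- Parity of a row or column index in dimension `4|1`: the indices `1, …, 4`
(here `0, …, 3`) are even and the index `5` (here `4`) is odd. -/
def p (i : Fin 5) : ZMod 2 := if i = 4 then 1 else 0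

/-- Parity of the matrix entry `a_ij`. -/
def entryParity (i j : Fin 5) : ZMod 2 := p i + p j

/-- The Koszul sign `(-1)^(e f)` of two parities. -/
def koszul (e f : ZMod 2) : Cq := (-1) ^ (e.val * f.val)

/-- `q^((-1)^(e + 1))`, that is, `q⁻¹` for `e` even and `q` for `e` odd. -/
def qPow (e : ZMod 2) : Cq := LaurentPolynomial.T ((-1 : ℤ) ^ (e.val + 1))

/-- Number of inversions (the length) of a permutation. -/
def permLength {n : ℕ} (σ : Equiv.Perm (Fin n)) : ℕ :=
  (Finset.univ.filter fun ij : Fin n × Fin n => ij.1 < ij.2 ∧ σ ij.2 < σ ij.1).card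

/-- The quantum determinant `∑_σ (-q)^(-l(σ)) b_{1 σ(1)} ⋯ b_{n σ(n)}` of a matrix with entries
in a noncommutative algebra. -/
def qDet {A : Type*} [Semiring A] [Algebra Cq A] {n : ℕ} (b : Fin n → Fin n → A) : A :=
  ∑ σ : Equiv.Perm (Fin n), (-qInv) ^ permLength σ • (List.ofFn fun i => b i (σ i)).prod

/-- The subspace of elements of parity `ε` in an algebra that is generated by homogeneous
elements `g s` of parity `π s`: the span of the words in the generators of total parity `ε`. -/
def superPart {A : Type*} [Semiring A] [Algebra Cq A] {S : Type*} (g : S → A) (π : S → ZMod 2)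
    (ε : ZMod 2) : Submodule Cq A :=
  Submodule.span Cq {w | ∃ l : List S, (l.map π).sum = ε ∧ w = (l.map g).prod}

/-! ### The quantum special linear supergroup -/

/-- Generators: the matrix entries `a_ij` and the inverses of the quantum determinants
`D₁` (of the even-even `4 × 4` block) and `D₂ = a₅₅` (of the odd-odd `1 × 1` block). -/
inductive SLGen : Type
  | a (i j : Fin 5)
  | D₁inv
  | D₂inv

/-- Parity of the generators. -/
def SLGen.parity : SLGen → ZMod 2
  | .a i j => entryParity i j
  | .D₁inv => 0
  | .D₂inv => 0

abbrev SLFree : Type := FreeAlgebra Cq SLGen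

namespace SLFree

def a (i j : Fin 5) : SLFree := FreeAlgebra.ι Cq (SLGen.a i j)

def D₁inv : SLFree := FreeAlgebra.ι Cq SLGen.D₁inv

def D₂inv : SLFree := FreeAlgebra.ι Cq SLGen.D₂inv

/-- Quantum determinant of the even-even block. -/
def D₁ : SLFree := qDet fun i j : Fin 4 => a i.castSucc j.castSucc

/-- Quantum determinant of the odd-odd block. -/
def D₂ : SLFree := a 4 4

/-- The quantum Berezinian `det_q (A - B D⁻¹ C) · det_q(D)⁻¹` of the block matrix
`[[A, B], [C, D]]`. -/
def ber : SLFree :=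
  qDet (fun i j : Fin 4 =>
    a i.castSucc j.castSucc - a i.castSucc 4 * D₂inv * a 4 j.castSucc) * D₂inv

end SLFree

open SLFree in
/-- The relations of `SL_q(4|1)`: the Manin relations together with `ξ² = 0` for the odd
entries (these define the quantum matrix superalgebra `M_q(4|1)`), invertibility of
`D₁` and `D₂` (these define `GL_q(4|1)`), and `Ber_q = 1`. -/
inductive SLRel : SLFree → SLFree → Prop
  | odd_sq (i j : Fin 5) (h : entryParity i j = 1) : SLRel (a i j * a i j) 0
  | row (i j l : Fin 5) (h : j < l) :
      SLRel (a i j * a i l)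
        ((koszul (entryParity i j) (entryParity i l) * qPow (p i)) • (a i l * a i j))
  | col (i j k : Fin 5) (h : i < k) :
      SLRel (a i j * a k j)
        ((koszul (entryParity i j) (entryParity k j) * qPow (p j)) • (a k j * a i j))
  | anti (i j k l : Fin 5) (h : (i < k ∧ l < j) ∨ (k < i ∧ j < l)) :
      SLRel (a i j * a k l) (koszul (entryParity i j) (entryParity k l) • (a k l * a i j))
  | diag (i j k l : Fin 5) (h : i < k) (h' : j < l) :
      SLRel (a i j * a k l - koszul (entryParity i j) (entryParity k l) • (a k l * a i j))
        ((koszul (entryParity i j) (entryParity k j) * (qInv - q)) • (a k j * a i l))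
  | D₁_mul_inv : SLRel (D₁ * D₁inv) 1
  | inv_mul_D₁ : SLRel (D₁inv * D₁) 1
  | D₂_mul_inv : SLRel (D₂ * D₂inv) 1
  | inv_mul_D₂ : SLRel (D₂inv * D₂) 1
  | ber_eq_one : SLRel ber 1

/-- The quantum special linear supergroup `O(SL_q(4|1))`. -/
abbrev SLq : Type := RingQuot SLRel

/-- The class of a generator in `O(SL_q(4|1))`. -/
def SLq.gen (s : SLGen) : SLq := RingQuot.mkAlgHom Cq SLRel (FreeAlgebra.ι Cq s)

/-! ### The quantum lower parabolic supergroup -/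

/-- The generators `g_1j, g_2j` (`j = 3, 4`) and `γ_15, γ_25` are set to zero. -/
inductive ParabolicRel : SLq → SLq → Prop
  | zero (i j : Fin 5) (hi : i < 2) (hj : 2 ≤ j) : ParabolicRel (SLq.gen (.a i j)) 0

/-- The quantum lower parabolic supergroup `O(P_{l,q})`. -/
abbrev OPlq : Type := RingQuot ParabolicRel

namespace OPlq

/-- The class of a generator of `O(SL_q(4|1))` in `O(P_{l,q})`. -/
def gen (s : SLGen) : OPlq := RingQuot.mkAlgHom Cq ParabolicRel (SLq.gen s)

/-- The upper left block `x`, with rows `1, 2` and columns `1, 2`. -/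
def x : Matrix (Fin 2) (Fin 2) OPlq :=
  Matrix.of ![![gen (.a 0 0), gen (.a 0 1)], ![gen (.a 1 0), gen (.a 1 1)]]

/-- The block `t x`, with rows `3, 4` and columns `1, 2`. -/
def tx : Matrix (Fin 2) (Fin 2) OPlq :=
  Matrix.of ![![gen (.a 2 0), gen (.a 2 1)], ![gen (.a 3 0), gen (.a 3 1)]]

/-- The block `τ̃ x`, with row `5` and columns `1, 2`. -/
def τx : Matrix (Fin 1) (Fin 2) OPlq :=
  Matrix.of ![![gen (.a 4 0), gen (.a 4 1)]]

/-- The matrix `t`, the solution of `t x = (g_ij)`, `i = 3, 4`, `j = 1, 2`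
(`Ring.inverse x` is the two-sided inverse of the matrix `x`, given that `x` is a unit). -/
def t : Matrix (Fin 2) (Fin 2) OPlq := tx * Ring.inverse x

/-- The row `τ̃`, the solution of `τ̃ x = (γ_51, γ_52)`. -/
def τ : Matrix (Fin 1) (Fin 2) OPlq := τx * Ring.inverse x

end OPlq

/-- The quantum big cell `O_q(U_12)`: the subalgebra of `O(P_{l,q})` generated by the
entries of `t` and `τ̃`. -/
def bigCell : Subalgebra Cq OPlq :=
  Algebra.adjoin Cq ({z | ∃ i j, z = OPlq.t i j} ∪ {z | ∃ j, z = OPlq.τ 0 j})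

/-! ### The presented superalgebra -/

/-- Generators: `t i j` stands for `t_{3+i, 1+j}` and `τ j` for `τ̃_{5, 1+j}`. -/
inductive CellGen : Type
  | t (i j : Fin 2)
  | τ (j : Fin 2)

/-- Parity of the generators. -/
def CellGen.parity : CellGen → ZMod 2
  | .t _ _ => 0
  | .τ _ => 1

abbrev CellFree : Type := FreeAlgebra Cq CellGen

namespace CellFree

def t (i j : Fin 2) : CellFree := FreeAlgebra.ι Cq (CellGen.t i j)

def τ (j : Fin 2) : CellFree := FreeAlgebra.ι Cq (CellGen.τ j)

end CellFree

open CellFree in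
/-- The defining relations of the presentation. -/
inductive CellRel : CellFree → CellFree → Prop
  /-- Odd variables of a free superalgebra over `C_q` square to zero. -/
  | τ_sq (j : Fin 2) : CellRel (τ j * τ j) 0
  | t_row (i : Fin 2) : CellRel (t i 0 * t i 1) (q • (t i 1 * t i 0))
  | t_col (j : Fin 2) : CellRel (t 0 j * t 1 j) (qInv • (t 1 j * t 0 j))
  | t_comm : CellRel (t 0 0 * t 1 1) (t 1 1 * t 0 0)
  | t_cross : CellRel (t 0 1 * t 1 0) (t 1 0 * t 0 1 + (qInv - q) • (t 1 1 * t 0 0))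
  | τ_row : CellRel (τ 0 * τ 1) (-(qInv • (τ 1 * τ 0)))
  | tτ_col (i j : Fin 2) : CellRel (t i j * τ j) (qInv • (τ j * t i j))
  | tτ_comm (i : Fin 2) : CellRel (t i 0 * τ 1) (τ 1 * t i 0)
  | tτ_cross (i : Fin 2) :
      CellRel (t i 1 * τ 0) (τ 0 * t i 1 + (qInv - q) • (t i 0 * τ 1))

/-- The superalgebra `C_q⟨t_ij, τ̃_5j⟩ / I_U`. -/
abbrev CellPres : Type := RingQuot CellRel

/-- The class of a generator in the presented superalgebra. -/
def CellPres.gen (s : CellGen) : CellPres := RingQuot.mkAlgHom Cq CellRel (FreeAlgebra.ι Cq s)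

end QuantumBigCell

end

noncomputable section

namespace QuantumBigCell

/-! In `OPlq` the entries in rows 1, 2 and columns 3, 4, 5 vanish. Hence `D₁` factors as `detX *
detY`, the quantum determinants of the two even diagonal blocks, and these commute. As `D₁` is
invertible, so is `detX`, and the quantum adjugate divided by `detX` inverts `x`. By Cramer's rule
the entries of `t` and `τ̃` are quotients by `detX` of 2×2 quantum minors, taken from row `i` and
one row of `x`. Moving `detXInv` past any such minor costs the same factor `q`, so the quotients
satisfy the same quadratic relations as the minors, and those follow from Manin's relations by
rewriting words. This gives a homomorphism `CellPres.toOPlq` with image `bigCell`.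

The main point is injectivity. No basis of `OPlq` is needed: `OPlq` is made to act on the presented
algebra so that `t_ij` and `τ̃_5j` act by left multiplication (`Cell.action_t`, `Cell.action_τ`).
Then the image of `z` sends `1` to `z`, so `z` is recovered from its image.

To build the action, the diagonal blocks are moved to the right past words of the big cell and act
on `1` through the counit. The rules for moving them are two homomorphisms `rhoX`, `rhoY` to
matrices over the presented algebra; their coefficients are the operators `K` and `E`. A triangular
quotient suffices, so all entries above the diagonal act by zero. Then `Ber_q = 1` forces `a_55` to
act as `D₁`, that is, as `K₁ K₂ K₃ K₄`, and the entries below `x` must act as the entries of `t x`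
and `τ̃ x`. The Manin relations become a finite check on operators.

The same action handles parity: it takes homogeneous elements to homogeneous operators, and
evaluation at the even element `1` shows that the isomorphism reflects parity as well as preserving
it. -/

theorem q_mul_qInv : q * qInv = 1 := by
  rw [q, qInv, ← LaurentPolynomial.T_add, add_neg_cancel, LaurentPolynomial.T_zero]

/-- The trailing factor `z` lets rules of the form `a * (b * z) = …` rewrite every adjacent pair of
a right-associated word, including the last one. -/
theorem eq_of_forall_mul_eq {A : Type*} [Monoid A] {u v : A} (h : ∀ z, u * z = v * z) : u = v := by
  simpa using h 1

/-! ### Quantum minors of a 2×2 block and the rows below it -/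

section Minors

variable {A : Type*} [Ring A] [Algebra Cq A]

/-- The relations of a quantum `2 × 2` matrix, in a form fit for rewriting words. -/
structure IsQuantumMatrix (a b c d : A) : Prop where
  ab (z : A) : a * (b * z) = qInv • (b * (a * z))
  ac (z : A) : a * (c * z) = qInv • (c * (a * z))
  bd (z : A) : b * (d * z) = qInv • (d * (b * z))
  cd (z : A) : c * (d * z) = qInv • (d * (c * z))
  bc (z : A) : b * (c * z) = c * (b * z)
  ad (z : A) : a * (d * z) = d * (a * z) + (qInv - q) • (c * (b * z))

/-- The relations between a quantum `2 × 2` matrix and a row `(e, f)` below it. -/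
structure IsLowerRow (a b c d e f : A) : Prop where
  ae (z : A) : a * (e * z) = qInv • (e * (a * z))
  be (z : A) : b * (e * z) = e * (b * z)
  ce (z : A) : c * (e * z) = qInv • (e * (c * z))
  de (z : A) : d * (e * z) = e * (d * z)
  af (z : A) : a * (f * z) = f * (a * z) + (qInv - q) • (e * (b * z))
  bf (z : A) : b * (f * z) = qInv • (f * (b * z))
  cf (z : A) : c * (f * z) = f * (c * z) + (qInv - q) • (e * (d * z))
  df (z : A) : d * (f * z) = qInv • (f * (d * z))

variable {a b c d e f e' f' : A}

/-- The quantum determinant of a `2 × 2` matrix. -/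
def detTwo (a b c d : A) : A := a * d - qInv • (b * c)

/-- The minor `t_1 det x`. -/
def minorOne (c d e f : A) : A := e * d - qInv • (f * c)

/-- The minor `t_2 det x`. -/
def minorTwo (a b e f : A) : A := f * a - q • (e * b)

theorem detTwo_mul_a (hx : IsQuantumMatrix a b c d) :
    detTwo a b c d * a = a * detTwo a b c d := by
  have hq := q_mul_qInv
  refine eq_of_forall_mul_eq fun z => ?_
  simp only [minorOne, minorTwo, detTwo, mul_assoc, mul_add, mul_sub, add_mul, sub_mul, neg_mul,
    mul_neg, smul_mul_assoc, mul_smul_comm, smul_add, smul_sub, smul_neg, smul_smul, smul_zero,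
    zero_mul, mul_zero, hx.ab, hx.ac, hx.bd, hx.cd, hx.bc, hx.ad]
  match_scalars <;> grind

theorem detTwo_mul_b (hx : IsQuantumMatrix a b c d) :
    detTwo a b c d * b = b * detTwo a b c d := by
  have hq := q_mul_qInv
  refine eq_of_forall_mul_eq fun z => ?_
  simp only [minorOne, minorTwo, detTwo, mul_assoc, mul_add, mul_sub, add_mul, sub_mul, neg_mul,
    mul_neg, smul_mul_assoc, mul_smul_comm, smul_add, smul_sub, smul_neg, smul_smul, smul_zero,
    zero_mul, mul_zero, hx.ab, hx.ac, hx.bd, hx.cd, hx.bc, hx.ad]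

theorem detTwo_mul_c (hx : IsQuantumMatrix a b c d) :
    detTwo a b c d * c = c * detTwo a b c d := by
  have hq := q_mul_qInv
  refine eq_of_forall_mul_eq fun z => ?_
  simp only [minorOne, minorTwo, detTwo, mul_assoc, mul_add, mul_sub, add_mul, sub_mul, neg_mul,
    mul_neg, smul_mul_assoc, mul_smul_comm, smul_add, smul_sub, smul_neg, smul_smul, smul_zero,
    zero_mul, mul_zero, hx.ab, hx.ac, hx.bd, hx.cd, hx.bc, hx.ad]

theorem detTwo_mul_d (hx : IsQuantumMatrix a b c d) :
    detTwo a b c d * d = d * detTwo a b c d := by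
  have hq := q_mul_qInv
  refine eq_of_forall_mul_eq fun z => ?_
  simp only [minorOne, minorTwo, detTwo, mul_assoc, mul_add, mul_sub, add_mul, sub_mul, neg_mul,
    mul_neg, smul_mul_assoc, mul_smul_comm, smul_add, smul_sub, smul_neg, smul_smul, smul_zero,
    zero_mul, mul_zero, hx.ab, hx.ac, hx.bd, hx.cd, hx.bc, hx.ad]
  match_scalars <;> grind

/-- The factor `qInv` is the same for both minors and does not depend on the row; this is what later
makes the denominators cancel uniformly. -/
theorem detTwo_mul_minorOne (hx : IsQuantumMatrix a b c d)
    (h : IsLowerRow a b c d e f) :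
    detTwo a b c d * minorOne c d e f = qInv • (minorOne c d e f * detTwo a b c d) := by
  have hq := q_mul_qInv
  refine eq_of_forall_mul_eq fun z => ?_
  simp only [minorOne, minorTwo, detTwo, mul_assoc, mul_add, mul_sub, add_mul, sub_mul, neg_mul,
    mul_neg, smul_mul_assoc, mul_smul_comm, smul_add, smul_sub, smul_neg, smul_smul, smul_zero,
    zero_mul, mul_zero, hx.ab, hx.ac, hx.bd, hx.cd, hx.bc, hx.ad, h.ae, h.be, h.ce, h.de, h.af, h.bf, h.cf, h.df]
  match_scalars <;> grind

theorem detTwo_mul_minorTwo (hx : IsQuantumMatrix a b c d)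
    (h : IsLowerRow a b c d e f) :
    detTwo a b c d * minorTwo a b e f = qInv • (minorTwo a b e f * detTwo a b c d) := by
  have hq := q_mul_qInv
  refine eq_of_forall_mul_eq fun z => ?_
  simp only [minorOne, minorTwo, detTwo, mul_assoc, mul_add, mul_sub, add_mul, sub_mul, neg_mul,
    mul_neg, smul_mul_assoc, mul_smul_comm, smul_add, smul_sub, smul_neg, smul_smul, smul_zero,
    zero_mul, mul_zero, hx.ab, hx.ac, hx.bd, hx.cd, hx.bc, hx.ad, h.ae, h.be, h.ce, h.de, h.af, h.bf, h.cf, h.df]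
  match_scalars <;> grind

theorem minorOne_mul_minorTwo (hx : IsQuantumMatrix a b c d) (h : IsLowerRow a b c d e f)
    (hr : ∀ z, e * (f * z) = qInv • (f * (e * z))) :
    minorOne c d e f * minorTwo a b e f = q • (minorTwo a b e f * minorOne c d e f) := by
  have hq := q_mul_qInv
  refine eq_of_forall_mul_eq fun z => ?_
  simp only [minorOne, minorTwo, detTwo, mul_assoc, mul_add, mul_sub, add_mul, sub_mul, neg_mul,
    mul_neg, smul_mul_assoc, mul_smul_comm, smul_add, smul_sub, smul_neg, smul_smul, smul_zero,
    zero_mul, mul_zero, hx.ab, hx.ac, hx.bd, hx.cd, hx.bc, hx.ad, h.ae, h.be, h.ce, h.de, h.af, h.bf, h.cf, h.df, hr]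
  match_scalars <;> grind

/-- The case of row 5: the entries of an odd row anticommute up to `q` and square to zero, and
passing to the minors turns `q` into `qInv`. -/
theorem minorOne_mul_minorTwo_of_odd (hx : IsQuantumMatrix a b c d) (h : IsLowerRow a b c d e f)
    (hr : ∀ z, e * (f * z) = -(q • (f * (e * z)))) (he : ∀ z, e * (e * z) = 0)
    (hf : ∀ z, f * (f * z) = 0) :
    minorOne c d e f * minorTwo a b e f = -(qInv • (minorTwo a b e f * minorOne c d e f)) := by
  have hq := q_mul_qInv
  refine eq_of_forall_mul_eq fun z => ?_
  simp only [minorOne, minorTwo, detTwo, mul_assoc, mul_add, mul_sub, add_mul, sub_mul, neg_mul,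
    mul_neg, smul_mul_assoc, mul_smul_comm, smul_add, smul_sub, smul_neg, smul_smul, smul_zero,
    zero_mul, mul_zero, hx.ab, hx.ac, hx.bd, hx.cd, hx.bc, hx.ad, h.ae, h.be, h.ce, h.de, h.af, h.bf, h.cf, h.df, hr, he, hf]
  match_scalars <;> grind

theorem minorOne_mul_self_of_odd (hx : IsQuantumMatrix a b c d) (h : IsLowerRow a b c d e f)
    (hr : ∀ z, e * (f * z) = -(q • (f * (e * z)))) (he : ∀ z, e * (e * z) = 0)
    (hf : ∀ z, f * (f * z) = 0) :
    minorOne c d e f * minorOne c d e f = 0 := by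
  have hq := q_mul_qInv
  refine eq_of_forall_mul_eq fun z => ?_
  simp only [minorOne, minorTwo, detTwo, mul_assoc, mul_add, mul_sub, add_mul, sub_mul, neg_mul,
    mul_neg, smul_mul_assoc, mul_smul_comm, smul_add, smul_sub, smul_neg, smul_smul, smul_zero,
    zero_mul, mul_zero, hx.ab, hx.ac, hx.bd, hx.cd, hx.bc, hx.ad, h.ae, h.be, h.ce, h.de, h.af, h.bf, h.cf, h.df, hr, he, hf]
  match_scalars <;> grind

theorem minorTwo_mul_self_of_odd (hx : IsQuantumMatrix a b c d) (h : IsLowerRow a b c d e f)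
    (hr : ∀ z, e * (f * z) = -(q • (f * (e * z)))) (he : ∀ z, e * (e * z) = 0)
    (hf : ∀ z, f * (f * z) = 0) :
    minorTwo a b e f * minorTwo a b e f = 0 := by
  have hq := q_mul_qInv
  refine eq_of_forall_mul_eq fun z => ?_
  simp only [minorOne, minorTwo, detTwo, mul_assoc, mul_add, mul_sub, add_mul, sub_mul, neg_mul,
    mul_neg, smul_mul_assoc, mul_smul_comm, smul_add, smul_sub, smul_neg, smul_smul, smul_zero,
    zero_mul, mul_zero, hx.ab, hx.ac, hx.bd, hx.cd, hx.bc, hx.ad, h.ae, h.be, h.ce, h.de, h.af, h.bf, h.cf, h.df, hr, he, hf]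
  match_scalars <;> grind

/-- The relations between two rows `(e, f)` and `(e', f')`, the second below the first. -/
structure IsRowPair (e f e' f' : A) : Prop where
  ee (z : A) : e * (e' * z) = qInv • (e' * (e * z))
  ff (z : A) : f * (f' * z) = qInv • (f' * (f * z))
  fe (z : A) : f * (e' * z) = e' * (f * z)
  ef (z : A) : e * (f' * z) = f' * (e * z) + (qInv - q) • (e' * (f * z))

theorem minorOne_mul_minorOne (hx : IsQuantumMatrix a b c d) (h : IsLowerRow a b c d e f)
    (h' : IsLowerRow a b c d e' f') (hp : IsRowPair e f e' f') :
    minorOne c d e f * minorOne c d e' f' = qInv • (minorOne c d e' f' * minorOne c d e f) := by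
  have hq := q_mul_qInv
  refine eq_of_forall_mul_eq fun z => ?_
  simp only [minorOne, minorTwo, detTwo, mul_assoc, mul_add, mul_sub, add_mul, sub_mul, neg_mul,
    mul_neg, smul_mul_assoc, mul_smul_comm, smul_add, smul_sub, smul_neg, smul_smul, smul_zero,
    zero_mul, mul_zero, hx.ab, hx.ac, hx.bd, hx.cd, hx.bc, hx.ad, h.ae, h.be, h.ce, h.de, h.af, h.bf, h.cf, h.df, h'.ae, h'.be, h'.ce, h'.de, h'.af, h'.bf, h'.cf, h'.df, hp.ee, hp.ff, hp.fe, hp.ef]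
  match_scalars <;> grind

theorem minorTwo_mul_minorTwo (hx : IsQuantumMatrix a b c d) (h : IsLowerRow a b c d e f)
    (h' : IsLowerRow a b c d e' f') (hp : IsRowPair e f e' f') :
    minorTwo a b e f * minorTwo a b e' f' = qInv • (minorTwo a b e' f' * minorTwo a b e f) := by
  have hq := q_mul_qInv
  refine eq_of_forall_mul_eq fun z => ?_
  simp only [minorOne, minorTwo, detTwo, mul_assoc, mul_add, mul_sub, add_mul, sub_mul, neg_mul,
    mul_neg, smul_mul_assoc, mul_smul_comm, smul_add, smul_sub, smul_neg, smul_smul, smul_zero,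
    zero_mul, mul_zero, hx.ab, hx.ac, hx.bd, hx.cd, hx.bc, hx.ad, h.ae, h.be, h.ce, h.de, h.af, h.bf, h.cf, h.df, h'.ae, h'.be, h'.ce, h'.de, h'.af, h'.bf, h'.cf, h'.df, hp.ee, hp.ff, hp.fe, hp.ef]
  match_scalars <;> grind

theorem minorOne_mul_minorTwo_of_rowPair (hx : IsQuantumMatrix a b c d) (h : IsLowerRow a b c d e f)
    (h' : IsLowerRow a b c d e' f') (hp : IsRowPair e f e' f') :
    minorOne c d e f * minorTwo a b e' f' = minorTwo a b e' f' * minorOne c d e f := by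
  have hq := q_mul_qInv
  refine eq_of_forall_mul_eq fun z => ?_
  simp only [minorOne, minorTwo, detTwo, mul_assoc, mul_add, mul_sub, add_mul, sub_mul, neg_mul,
    mul_neg, smul_mul_assoc, mul_smul_comm, smul_add, smul_sub, smul_neg, smul_smul, smul_zero,
    zero_mul, mul_zero, hx.ab, hx.ac, hx.bd, hx.cd, hx.bc, hx.ad, h.ae, h.be, h.ce, h.de, h.af, h.bf, h.cf, h.df, h'.ae, h'.be, h'.ce, h'.de, h'.af, h'.bf, h'.cf, h'.df, hp.ee, hp.ff, hp.fe, hp.ef]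
  match_scalars <;> grind

theorem minorTwo_mul_minorOne (hx : IsQuantumMatrix a b c d) (h : IsLowerRow a b c d e f)
    (h' : IsLowerRow a b c d e' f') (hp : IsRowPair e f e' f') :
    minorTwo a b e f * minorOne c d e' f' =
      minorOne c d e' f' * minorTwo a b e f + (qInv - q) • (minorTwo a b e' f' * minorOne c d e f) := by
  have hq := q_mul_qInv
  refine eq_of_forall_mul_eq fun z => ?_
  simp only [minorOne, minorTwo, detTwo, mul_assoc, mul_add, mul_sub, add_mul, sub_mul, neg_mul,
    mul_neg, smul_mul_assoc, mul_smul_comm, smul_add, smul_sub, smul_neg, smul_smul, smul_zero,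
    zero_mul, mul_zero, hx.ab, hx.ac, hx.bd, hx.cd, hx.bc, hx.ad, h.ae, h.be, h.ce, h.de, h.af, h.bf, h.cf, h.df, h'.ae, h'.be, h'.ce, h'.de, h'.af, h'.bf, h'.cf, h'.df, hp.ee, hp.ff, hp.fe, hp.ef]
  match_scalars <;> grind

end Minors

/-! ### Signs and parities -/

theorem qPow_zero : qPow 0 = qInv := rfl

theorem qPow_one : qPow 1 = q := rfl

theorem koszul_zero_left (e : ZMod 2) : koszul 0 e = 1 := by simp [koszul]

theorem koszul_zero_right (e : ZMod 2) : koszul e 0 = 1 := by simp [koszul]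

theorem koszul_one_one : koszul 1 1 = -1 := by simp [koszul, ZMod.val_one]

theorem p_of_ne {i : Fin 5} (h : i ≠ 4) : p i = 0 := if_neg h

theorem p_four : p 4 = 1 := rfl

theorem entryParity_of_ne {i j : Fin 5} (hi : i ≠ 4) (hj : j ≠ 4) : entryParity i j = 0 := by
  simp [entryParity, p_of_ne hi, p_of_ne hj]

theorem entryParity_four {j : Fin 5} (hj : j ≠ 4) : entryParity 4 j = 1 := by
  simp [entryParity, p_four, p_of_ne hj]

/-! ### Manin's relations in the parabolic and the invertibility of `x` -/

namespace OPlq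

instance : Ring OPlq := RingQuot.instRing (R := SLq) _

/-- The projection of the free algebra onto `O(P_{l,q})`. -/
def proj : SLFree →ₐ[Cq] OPlq :=
  (RingQuot.mkAlgHom Cq ParabolicRel).comp (RingQuot.mkAlgHom Cq SLRel)

/-- The class of the matrix entry `a_ij`. -/
abbrev g (i j : Fin 5) : OPlq := gen (.a i j)

theorem proj_a (i j : Fin 5) : proj (SLFree.a i j) = g i j := rfl

theorem proj_D₁inv : proj SLFree.D₁inv = gen .D₁inv := rfl

theorem proj_rel {u v : SLFree} (h : SLRel u v) : proj u = proj v :=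
  congrArg (RingQuot.mkAlgHom Cq ParabolicRel) (RingQuot.mkAlgHom_rel Cq h)

theorem g_eq_zero {i j : Fin 5} (hi : i < 2) (hj : 2 ≤ j) : g i j = 0 := by
  simpa [g, gen] using RingQuot.mkAlgHom_rel Cq (ParabolicRel.zero i j hi hj)

theorem g_sq {i j : Fin 5} (h : entryParity i j = 1) : g i j * g i j = 0 := by
  simpa [proj_a] using proj_rel (SLRel.odd_sq i j h)

theorem g_row (i : Fin 5) {j l : Fin 5} (h : j < l) : g i j * g i l =
    (koszul (entryParity i j) (entryParity i l) * qPow (p i)) • (g i l * g i j) := by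
  simpa only [map_mul, map_smul, proj_a] using proj_rel (SLRel.row i j l h)

theorem g_col {i k : Fin 5} (j : Fin 5) (h : i < k) : g i j * g k j =
    (koszul (entryParity i j) (entryParity k j) * qPow (p j)) • (g k j * g i j) := by
  simpa only [map_mul, map_smul, proj_a] using proj_rel (SLRel.col i j k h)

theorem g_anti {i j k l : Fin 5} (h : i < k) (h' : l < j) :
    g i j * g k l = koszul (entryParity i j) (entryParity k l) • (g k l * g i j) := by
  simpa only [map_mul, map_smul, proj_a] using proj_rel (SLRel.anti i j k l (.inl ⟨h, h'⟩))

theorem g_diag {i j k l : Fin 5} (h : i < k) (h' : j < l) :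
    g i j * g k l = koszul (entryParity i j) (entryParity k l) • (g k l * g i j) +
      (koszul (entryParity i j) (entryParity k j) * (qInv - q)) • (g k j * g i l) := by
  have := proj_rel (SLRel.diag i j k l h h')
  rw [map_sub, sub_eq_iff_eq_add'] at this
  simpa only [map_mul, map_smul, proj_a] using this

theorem g_row_of_ne {i j l : Fin 5} (h : j < l) (hi : i ≠ 4) (hl : l ≠ 4) (z : OPlq) :
    g i j * (g i l * z) = qInv • (g i l * (g i j * z)) := by
  rw [← mul_assoc, g_row i h, entryParity_of_ne hi hl, koszul_zero_right, p_of_ne hi, qPow_zero,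
    one_mul, smul_mul_assoc, mul_assoc]

theorem g_col_of_ne {i k j : Fin 5} (h : i < k) (hj : j ≠ 4) (z : OPlq) :
    g i j * (g k j * z) = qInv • (g k j * (g i j * z)) := by
  have hi : i ≠ 4 := (h.trans_le (Fin.le_last k)).ne
  rw [← mul_assoc, g_col j h, entryParity_of_ne hi hj, koszul_zero_left, p_of_ne hj, qPow_zero,
    one_mul, smul_mul_assoc, mul_assoc]

theorem g_anti_of_ne {i j k l : Fin 5} (h : i < k) (h' : l < j) (hj : j ≠ 4) (z : OPlq) :
    g i j * (g k l * z) = g k l * (g i j * z) := by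
  have hi : i ≠ 4 := (h.trans_le (Fin.le_last k)).ne
  rw [← mul_assoc, g_anti h h', entryParity_of_ne hi hj, koszul_zero_left, one_smul, mul_assoc]

/-- The upper left entry has a row and a column different from 5, so it is even and every Koszul
sign is trivial, even when the other entries are odd. -/
theorem g_diag_of_ne {i j k l : Fin 5} (h : i < k) (h' : j < l) (z : OPlq) :
    g i j * (g k l * z) = g k l * (g i j * z) + (qInv - q) • (g k j * (g i l * z)) := by
  have hi : i ≠ 4 := (h.trans_le (Fin.le_last k)).ne
  have hj : j ≠ 4 := (h'.trans_le (Fin.le_last l)).ne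
  rw [← mul_assoc, g_diag h h', entryParity_of_ne hi hj, koszul_zero_left, koszul_zero_left,
    one_smul, one_mul, add_mul, smul_mul_assoc, mul_assoc, mul_assoc]

theorem isQuantumMatrix_x : IsQuantumMatrix (g 0 0) (g 0 1) (g 1 0) (g 1 1) where
  ab := g_row_of_ne (by decide) (by decide) (by decide)
  ac := g_col_of_ne (by decide) (by decide)
  bd := g_col_of_ne (by decide) (by decide)
  cd := g_row_of_ne (by decide) (by decide) (by decide)
  bc := g_anti_of_ne (by decide) (by decide) (by decide)
  ad := g_diag_of_ne (by decide) (by decide)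

/-- Row 5 is included: each relation involves an entry of `x`, which is even, so no sign
distinguishes `γ_5j` from an even row. -/
theorem isLowerRow {i : Fin 5} (hi : 2 ≤ i) :
    IsLowerRow (g 0 0) (g 0 1) (g 1 0) (g 1 1) (g i 0) (g i 1) where
  ae := g_col_of_ne (lt_of_lt_of_le (by decide) hi) (by decide)
  be := g_anti_of_ne (lt_of_lt_of_le (by decide) hi) (by decide) (by decide)
  ce := g_col_of_ne (lt_of_lt_of_le (by decide) hi) (by decide)
  de := g_anti_of_ne (lt_of_lt_of_le (by decide) hi) (by decide) (by decide)
  af := g_diag_of_ne (lt_of_lt_of_le (by decide) hi) (by decide)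
  bf := g_col_of_ne (lt_of_lt_of_le (by decide) hi) (by decide)
  cf := g_diag_of_ne (lt_of_lt_of_le (by decide) hi) (by decide)
  df := g_col_of_ne (lt_of_lt_of_le (by decide) hi) (by decide)

theorem isRowPair {i k : Fin 5} (h : i < k) : IsRowPair (g i 0) (g i 1) (g k 0) (g k 1) where
  ee := g_col_of_ne h (by decide)
  ff := g_col_of_ne h (by decide)
  fe := g_anti_of_ne h (by decide) (by decide)
  ef := g_diag_of_ne h (by decide)

theorem g_four_row (z : OPlq) : g 4 0 * (g 4 1 * z) = -(q • (g 4 1 * (g 4 0 * z))) := by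
  rw [← mul_assoc, g_row 4 (by decide), entryParity_four (by decide), entryParity_four (by decide),
    koszul_one_one, p_four, qPow_one, neg_one_mul, neg_smul, neg_mul, smul_mul_assoc, mul_assoc]

theorem g_four_sq {j : Fin 5} (hj : j ≠ 4) (z : OPlq) : g 4 j * (g 4 j * z) = 0 := by
  rw [← mul_assoc, g_sq (entryParity_four hj), zero_mul]

/-- The quantum determinant of `x`. -/
def detX : OPlq := detTwo (g 0 0) (g 0 1) (g 1 0) (g 1 1)

/-- The quantum determinant of the block with rows and columns `3, 4`. -/
def detY : OPlq := detTwo (g 2 2) (g 2 3) (g 3 2) (g 3 3)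

theorem proj_D₁ : proj SLFree.D₁ = detX * detY := by
  -- A permutation that does not preserve the first two indices sends one of them to 3 or 4, so its
  -- term contains a vanishing entry. Four permutations remain.
  have hS : ∀ σ : Equiv.Perm (Fin 4),
      σ ∈ ({1, Equiv.swap 0 1, Equiv.swap 2 3, Equiv.swap 0 1 * Equiv.swap 2 3} :
        Finset (Equiv.Perm (Fin 4))) ∨ 2 ≤ σ 0 ∨ 2 ≤ σ 1 := by decide
  rw [SLFree.D₁, qDet, map_sum, ← Finset.sum_subset (Finset.subset_univ
    {1, Equiv.swap 0 1, Equiv.swap 2 3, Equiv.swap 0 1 * Equiv.swap 2 3})]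
  · have l1 : permLength (1 : Equiv.Perm (Fin 4)) = 0 := by decide
    have l2 : permLength (Equiv.swap 0 1 : Equiv.Perm (Fin 4)) = 1 := by decide
    have l3 : permLength (Equiv.swap 2 3 : Equiv.Perm (Fin 4)) = 1 := by decide
    have l4 : permLength (Equiv.swap 0 1 * Equiv.swap 2 3 : Equiv.Perm (Fin 4)) = 2 := by decide
    have s2 : (2 : Fin 4) ≠ 0 := by decide
    rw [Finset.sum_insert (by decide), Finset.sum_insert (by decide),
      Finset.sum_insert (by decide), Finset.sum_singleton]
    simp [l1, l2, l3, l4, List.ofFn_succ, proj_a, Equiv.swap_apply_def, detX, detY, detTwo,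
      mul_sub, sub_mul, mul_assoc]
    match_scalars <;> ring
  · intro σ _ hσ
    rcases (hS σ).resolve_left hσ with h | h
    · have : g 0 (σ 0).castSucc = 0 := g_eq_zero (by decide) h
      simp [List.ofFn_succ, proj_a, this]
    · have : g 1 (σ 1).castSucc = 0 := g_eq_zero (by decide) h
      simp [List.ofFn_succ, proj_a, this]

/-- The correction term of the diagonal relation contains `g i l`, which lies in the vanishing
block. -/
theorem g_commute {i j k l : Fin 5} (hi : i < 2) (hj : j < 2) (hk : 2 ≤ k) (hl : 2 ≤ l) :
    Commute (g i j) (g k l) := by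
  have h := g_diag_of_ne (hi.trans_le hk) (hj.trans_le hl) (1 : OPlq)
  rwa [g_eq_zero hi hl, zero_mul, mul_zero, smul_zero, add_zero, mul_one, mul_one] at h

theorem commute_detX {z : OPlq} (h : ∀ i j : Fin 5, i < 2 → j < 2 → Commute (g i j) z) :
    Commute detX z :=
  ((h 0 0 (by decide) (by decide)).mul_left (h 1 1 (by decide) (by decide))).sub_left
    (((h 0 1 (by decide) (by decide)).mul_left (h 1 0 (by decide) (by decide))).smul_left _)

theorem commute_detX_detY : Commute detX detY := by
  have h {k l : Fin 5} (hk : 2 ≤ k) (hl : 2 ≤ l) : Commute detX (g k l) :=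
    commute_detX fun i j hi hj => g_commute hi hj hk hl
  exact ((h (by decide) (by decide)).mul_right (h (by decide) (by decide))).sub_right
    (((h (by decide) (by decide)).mul_right (h (by decide) (by decide))).smul_right _)

/-- The inverse of `detX`. -/
def detXInv : OPlq := detY * gen .D₁inv

theorem detX_mul_detXInv : detX * detXInv = 1 := by
  rw [detXInv, ← mul_assoc, ← proj_D₁, ← proj_D₁inv, ← map_mul, proj_rel .D₁_mul_inv, map_one]

theorem detXInv_mul_detX : detXInv * detX = 1 := by
  have h : gen .D₁inv * detY * detX = 1 := by
    rw [mul_assoc, ← commute_detX_detY.eq, ← proj_D₁, ← proj_D₁inv, ← map_mul,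
      proj_rel .inv_mul_D₁, map_one]
  -- The left inverse coming from the other order of the factors coincides with the right inverse
  -- `detXInv`.
  rw [← left_inv_eq_right_inv h detX_mul_detXInv, h]

/-- The inverse of `detX` as a unit. -/
def detXUnit : OPlqˣ := ⟨detX, detXInv, detX_mul_detXInv, detXInv_mul_detX⟩

theorem detXInv_mul_of_comm {u : OPlq} (h : detX * u = u * detX) :
    detXInv * u = u * detXInv :=
  (show Commute (↑detXUnit : OPlq) u from h).units_inv_left.eq

theorem detXInv_mul_of_qComm {u : OPlq} (h : detX * u = qInv • (u * detX)) :
    detXInv * u = q • (u * detXInv) := by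
  -- Multiplying by `detXInv` on both sides moves the determinant across; the scalar `q` cancels
  -- `qInv`.
  have := congrArg (fun v => q • (detXInv * v * detXInv)) h
  simpa only [mul_smul_comm, smul_mul_assoc, smul_smul, q_mul_qInv, one_smul, mul_assoc,
    detX_mul_detXInv, mul_one, ← mul_assoc detXInv detX, detXInv_mul_detX, one_mul] using this.symm

/-- The quantum adjugate of `x` divided by the quantum determinant. -/
def xInv : Matrix (Fin 2) (Fin 2) OPlq :=
  Matrix.of ![![g 1 1 * detXInv, -(q • (g 0 1 * detXInv))],
    ![-(qInv • (g 1 0 * detXInv)), g 0 0 * detXInv]]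

theorem x_mul_xInv : x * xInv = 1 := by
  have hx := isQuantumMatrix_x
  have hq := q_mul_qInv
  have hD := detX_mul_detXInv
  simp only [detX, detTwo, sub_mul, smul_mul_assoc, mul_assoc] at hD
  rw [hx.bc] at hD
  ext i j
  fin_cases i <;> fin_cases j <;>
    simp [x, xInv, Matrix.mul_apply, hx.ab, hx.cd, hx.bc, ← sub_eq_add_neg,
      smul_smul, hq]
  · exact hD
  · rw [← hD, hx.ad]
    match_scalars <;> grind

theorem xInv_mul_x : xInv * x = 1 := by
  have hx := isQuantumMatrix_x
  have hq := q_mul_qInv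
  have hD := detX_mul_detXInv
  simp only [detX, detTwo, sub_mul, smul_mul_assoc, mul_assoc] at hD
  rw [hx.bc] at hD
  have ha := detXInv_mul_of_comm (detTwo_mul_a hx)
  have hb := detXInv_mul_of_comm (detTwo_mul_b hx)
  have hc := detXInv_mul_of_comm (detTwo_mul_c hx)
  have hd := detXInv_mul_of_comm (detTwo_mul_d hx)
  ext i j
  fin_cases i <;> fin_cases j <;>
    simp [x, xInv, Matrix.mul_apply, hx.ac, hx.bd, hx.bc, mul_assoc, ha, hb, hc, hd,
      smul_smul, hq]
  · rw [← hD, hx.ad]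
    match_scalars <;> grind
  · rw [← hD]
    match_scalars <;> grind

theorem isUnit_x : IsUnit x := ⟨⟨x, xInv, x_mul_xInv, xInv_mul_x⟩, rfl⟩

theorem inverse_x : Ring.inverse x = xInv :=
  Ring.inverse_unit ⟨x, xInv, x_mul_xInv, xInv_mul_x⟩

/-- The minor with rows `x` and columns `i`. -/
def minor (i : Fin 5) : Fin 2 → OPlq :=
  ![minorOne (g 1 0) (g 1 1) (g i 0) (g i 1), minorTwo (g 0 0) (g 0 1) (g i 0) (g i 1)]

theorem t_eq (i j : Fin 2) : t i j = minor (i.natAdd 2).castSucc j * detXInv := by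
  fin_cases i <;> fin_cases j <;>
    simp [t, tx, inverse_x, xInv, Matrix.mul_apply, minor, minorOne, minorTwo, sub_mul, mul_assoc] <;>
    abel

theorem τ_eq (j : Fin 2) : τ 0 j = minor 4 j * detXInv := by
  fin_cases j <;>
    simp [τ, τx, inverse_x, xInv, Matrix.mul_apply, minor, minorOne, minorTwo, sub_mul, mul_assoc] <;>
    abel

/-! ### Relations between the quotients of minors -/

theorem mul_detXInv_mul {u v : OPlq} (h : detX * v = qInv • (v * detX)) :
    u * detXInv * (v * detXInv) = q • (u * v * (detXInv * detXInv)) := by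
  rw [mul_assoc, ← mul_assoc detXInv v, detXInv_mul_of_qComm h]
  simp only [smul_mul_assoc, mul_smul_comm, mul_assoc]

theorem detX_mul_minor {i : Fin 5} (hi : 2 ≤ i) (j : Fin 2) :
    detX * minor i j = qInv • (minor i j * detX) := by
  fin_cases j
  · exact detTwo_mul_minorOne isQuantumMatrix_x (isLowerRow hi)
  · exact detTwo_mul_minorTwo isQuantumMatrix_x (isLowerRow hi)

/-- A quotient `minor i j / det x`. -/
def quot (i : Fin 5) (j : Fin 2) : OPlq := minor i j * detXInv

/-- The factor `q` and the denominator do not depend on the four indices, so any homogeneous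
quadratic relation between minors passes to the quotients unchanged. -/
theorem quot_mul_quot (i : Fin 5) {k : Fin 5} (hk : 2 ≤ k) (j l : Fin 2) :
    quot i j * quot k l = q • (minor i j * minor k l * (detXInv * detXInv)) :=
  mul_detXInv_mul (detX_mul_minor hk l)

theorem quot_row {i : Fin 5} (hi : 2 ≤ i) (hi' : i ≠ 4) :
    quot i 0 * quot i 1 = q • (quot i 1 * quot i 0) := by
  have h : minor i 0 * minor i 1 = q • (minor i 1 * minor i 0) :=
    minorOne_mul_minorTwo isQuantumMatrix_x (isLowerRow hi)
      (g_row_of_ne (by decide) hi' (by decide))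
  rw [quot_mul_quot i hi, quot_mul_quot i hi, h, smul_mul_assoc]

theorem quot_four_row : quot 4 0 * quot 4 1 = -(qInv • (quot 4 1 * quot 4 0)) := by
  have h : minor 4 0 * minor 4 1 = -(qInv • (minor 4 1 * minor 4 0)) :=
    minorOne_mul_minorTwo_of_odd isQuantumMatrix_x (isLowerRow (by decide))
      g_four_row (g_four_sq (by decide)) (g_four_sq (by decide))
  rw [quot_mul_quot 4 (by decide), quot_mul_quot 4 (by decide), h, neg_mul, smul_mul_assoc,
    smul_neg, smul_comm]

theorem quot_four_sq (j : Fin 2) : quot 4 j * quot 4 j = 0 := by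
  have h : minor 4 j * minor 4 j = 0 := by
    fin_cases j
    · exact minorOne_mul_self_of_odd isQuantumMatrix_x (isLowerRow (by decide))
        g_four_row (g_four_sq (by decide)) (g_four_sq (by decide))
    · exact minorTwo_mul_self_of_odd isQuantumMatrix_x (isLowerRow (by decide))
        g_four_row (g_four_sq (by decide)) (g_four_sq (by decide))
  rw [quot_mul_quot 4 (by decide), h, zero_mul, smul_zero]

variable {i k : Fin 5}

theorem quot_col (hi : 2 ≤ i) (h : i < k) (j : Fin 2) :
    quot i j * quot k j = qInv • (quot k j * quot i j) := by
  have hk := hi.trans h.le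
  have hm : minor i j * minor k j = qInv • (minor k j * minor i j) := by
    fin_cases j
    · exact minorOne_mul_minorOne isQuantumMatrix_x (isLowerRow hi) (isLowerRow hk) (isRowPair h)
    · exact minorTwo_mul_minorTwo isQuantumMatrix_x (isLowerRow hi) (isLowerRow hk) (isRowPair h)
  rw [quot_mul_quot i hk, quot_mul_quot k hi, hm, smul_mul_assoc, smul_comm]

theorem quot_comm (hi : 2 ≤ i) (h : i < k) : quot i 0 * quot k 1 = quot k 1 * quot i 0 := by
  have hk := hi.trans h.le
  have hm : minor i 0 * minor k 1 = minor k 1 * minor i 0 :=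
    minorOne_mul_minorTwo_of_rowPair isQuantumMatrix_x (isLowerRow hi) (isLowerRow hk)
      (isRowPair h)
  rw [quot_mul_quot i hk, quot_mul_quot k hi, hm]

theorem quot_cross (hi : 2 ≤ i) (h : i < k) :
    quot i 1 * quot k 0 = quot k 0 * quot i 1 + (qInv - q) • (quot k 1 * quot i 0) := by
  have hk := hi.trans h.le
  have hm : minor i 1 * minor k 0 =
      minor k 0 * minor i 1 + (qInv - q) • (minor k 1 * minor i 0) :=
    minorTwo_mul_minorOne isQuantumMatrix_x (isLowerRow hi) (isLowerRow hk) (isRowPair h)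
  rw [quot_mul_quot i hk, quot_mul_quot k hi, quot_mul_quot k hi, hm, add_mul, smul_add,
    smul_mul_assoc, smul_comm q]

end OPlq

/-! ### The homomorphism onto the big cell -/

namespace CellPres

/-- The images of the generators of the presented algebra in `O(P_{l,q})`. -/
def genImage : CellGen → OPlq
  | .t i j => OPlq.quot (i.natAdd 2).castSucc j
  | .τ j => OPlq.quot 4 j

/-- The homomorphism from the presented algebra to `O(P_{l,q})`. -/
def toOPlq : CellPres →ₐ[Cq] OPlq :=
  RingQuot.liftAlgHom Cq ⟨FreeAlgebra.lift Cq genImage, by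
    have h (i : Fin 2) : 2 ≤ (i.natAdd 2).castSucc := by revert i; decide
    have h4 (i : Fin 2) : (i.natAdd 2).castSucc ≠ 4 := by revert i; decide
    have h4' (i : Fin 2) : (i.natAdd 2).castSucc < 4 := by revert i; decide
    have h01 : ((0 : Fin 2).natAdd 2).castSucc < ((1 : Fin 2).natAdd 2).castSucc := by decide
    intro u v r
    cases r <;> simp only [map_mul, map_add, map_neg, map_smul, map_zero, CellFree.t, CellFree.τ,
      FreeAlgebra.lift_ι_apply, genImage]
    · exact OPlq.quot_four_sq _
    · exact OPlq.quot_row (h _) (h4 _)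
    · exact OPlq.quot_col (h _) h01 _
    · exact OPlq.quot_comm (h _) h01
    · exact OPlq.quot_cross (h _) h01
    · exact OPlq.quot_four_row
    · exact OPlq.quot_col (h _) (h4' _) _
    · exact OPlq.quot_comm (h _) (h4' _)
    -- The defining relation has `t_i1 τ̃_52` in its correction term, while the relation between
    -- quotients has the factors in the opposite order.
    · rw [OPlq.quot_comm (h _) (h4' _)]
      exact OPlq.quot_cross (h _) (h4' _)⟩

theorem toOPlq_gen (s : CellGen) : toOPlq (gen s) = genImage s := by
  simp [toOPlq, gen]

theorem toOPlq_t (i j : Fin 2) : toOPlq (gen (.t i j)) = OPlq.t i j := by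
  rw [toOPlq_gen, OPlq.t_eq]; rfl

theorem toOPlq_τ (j : Fin 2) : toOPlq (gen (.τ j)) = OPlq.τ 0 j := by
  rw [toOPlq_gen, OPlq.τ_eq]; rfl

end CellPres

theorem algHom_range_eq_adjoin {S A : Type*} [Semiring A] [Algebra Cq A]
    (r : FreeAlgebra Cq S → FreeAlgebra Cq S → Prop)
    (f : RingQuot r →ₐ[Cq] A) :
    f.range = Algebra.adjoin Cq
      (Set.range fun s => f (RingQuot.mkAlgHom Cq r (FreeAlgebra.ι Cq s))) := by
  have h : (⊤ : Subalgebra Cq (RingQuot r)) = (RingQuot.mkAlgHom Cq r).range :=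
    ((AlgHom.range_eq_top _).2 (RingQuot.mkAlgHom_surjective Cq r)).symm
  rw [← Algebra.map_top, h, ← Algebra.map_top, ← FreeAlgebra.adjoin_range_ι, AlgHom.map_adjoin,
    AlgHom.map_adjoin, ← Set.range_comp, ← Set.range_comp]
  rfl

theorem CellPres.range_toOPlq : toOPlq.range = bigCell := by
  rw [algHom_range_eq_adjoin, bigCell]
  congr 1
  ext z
  constructor
  · rintro ⟨s | s, rfl⟩
    · exact .inl ⟨_, _, toOPlq_t _ _⟩
    · exact .inr ⟨_, toOPlq_τ _⟩
  · rintro (⟨i, j, rfl⟩ | ⟨j, rfl⟩)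
    · exact ⟨.t i j, toOPlq_t _ _⟩
    · exact ⟨.τ j, toOPlq_τ _⟩

/-! ### Parity, and its preservation by the homomorphism -/

section SuperPart

variable {A : Type*} [Semiring A] [Algebra Cq A] {S : Type*} {g : S → A} {π : S → ZMod 2}

theorem gen_mem_superPart (s : S) : g s ∈ superPart g π (π s) :=
  Submodule.subset_span ⟨[s], by simp, by simp⟩

theorem one_mem_superPart : (1 : A) ∈ superPart g π 0 :=
  Submodule.subset_span ⟨[], by simp, by simp⟩

theorem mul_mem_superPart {ε δ : ZMod 2} {u v : A} (hu : u ∈ superPart g π ε)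
    (hv : v ∈ superPart g π δ) : u * v ∈ superPart g π (ε + δ) := by
  have : superPart g π ε * superPart g π δ ≤ superPart g π (ε + δ) := by
    rw [superPart, superPart, Submodule.span_mul_span, Submodule.span_le]
    rintro _ ⟨_, ⟨l, rfl, rfl⟩, _, ⟨m, rfl, rfl⟩, rfl⟩
    exact Submodule.subset_span ⟨l ++ m, by simp, by simp⟩
  exact this (Submodule.mul_mem_mul hu hv)

theorem superPart_induction {M : Type*} [AddCommMonoid M] [Module Cq M] {N : Submodule Cq M}
    (f : A →ₗ[Cq] M) {ε : ZMod 2} (h : ∀ l : List S, (l.map π).sum = ε → f (l.map g).prod ∈ N)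
    {u : A} (hu : u ∈ superPart g π ε) : f u ∈ N := by
  have : superPart g π ε ≤ N.comap f := by
    rw [superPart, Submodule.span_le]
    rintro _ ⟨l, hl, rfl⟩
    exact h l hl
  exact this hu

theorem map_list_prod_mem_superPart {B T : Type*} [Semiring B] [Algebra Cq B] {g' : T → B}
    {π' : T → ZMod 2} (f : A →ₐ[Cq] B) (h : ∀ s, f (g s) ∈ superPart g' π' (π s)) (l : List S) :
    f (l.map g).prod ∈ superPart g' π' (l.map π).sum := by
  induction l with
  | nil => simpa using one_mem_superPart
  | cons s l ih => simpa using mul_mem_superPart (h s) ih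

end SuperPart

namespace OPlq

theorem gen_mem (s : SLGen) : gen s ∈ superPart gen SLGen.parity s.parity :=
  gen_mem_superPart s

theorem g_mul_g_mem {i j k l : Fin 5} {ε : ZMod 2}
    (h : entryParity i j + entryParity k l = ε) :
    g i j * g k l ∈ superPart gen SLGen.parity ε :=
  h ▸ mul_mem_superPart (gen_mem (.a i j)) (gen_mem (.a k l))

theorem detXInv_mem : detXInv ∈ superPart gen SLGen.parity 0 := by
  have : detY ∈ superPart gen SLGen.parity 0 :=
    sub_mem (g_mul_g_mem (by decide)) (Submodule.smul_mem _ _ (g_mul_g_mem (by decide)))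
  simpa [detXInv, SLGen.parity] using mul_mem_superPart this (gen_mem .D₁inv)

/-- Columns 1, 2 and the rows of `x` are even, so only the row `i` contributes to the parity. -/
theorem minor_mem (i : Fin 5) (j : Fin 2) :
    minor i j ∈ superPart gen SLGen.parity (p i) := by
  fin_cases j <;>
    exact sub_mem (g_mul_g_mem (by revert i; decide))
      (Submodule.smul_mem _ _ (g_mul_g_mem (by revert i; decide)))

theorem quot_mem (i : Fin 5) (j : Fin 2) : quot i j ∈ superPart gen SLGen.parity (p i) := by
  simpa [quot] using mul_mem_superPart (minor_mem i j) detXInv_mem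

end OPlq

theorem CellPres.toOPlq_mem {ε : ZMod 2} {z : CellPres}
    (hz : z ∈ superPart gen CellGen.parity ε) :
    toOPlq z ∈ superPart OPlq.gen SLGen.parity ε := by
  refine superPart_induction toOPlq.toLinearMap (fun l hl => ?_) hz
  refine hl ▸ map_list_prod_mem_superPart toOPlq (fun s => ?_) l
  rw [toOPlq_gen]
  rcases s with ⟨i, j⟩ | j
  · have := OPlq.quot_mem (i.natAdd 2).castSucc j
    rwa [p_of_ne ((by decide : ∀ i : Fin 2, (i.natAdd 2).castSucc ≠ 4) i)] at this
  · exact OPlq.quot_mem 4 j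

/-- A copy of the presented algebra whose ring structure is not unfolded by unification. -/
def Cell : Type := CellPres

/-! ### Operators on the presented algebra -/

namespace Cell

instance : Ring Cell := inferInstanceAs (Ring CellPres)

instance : Algebra Cq Cell := inferInstanceAs (Algebra Cq CellPres)

/-- The identification of the two copies of the presented algebra. -/
def ofPres : CellPres ≃ₐ[Cq] Cell := AlgEquiv.refl (A₁ := CellPres)

/-- The projection of the free algebra. -/
def mk : CellFree →ₐ[Cq] Cell := ofPres.toAlgHom.comp (RingQuot.mkAlgHom Cq CellRel)

theorem mk_surjective : Function.Surjective mk :=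
  ofPres.surjective.comp (RingQuot.mkAlgHom_surjective Cq CellRel)

theorem mk_rel {u v : CellFree} (h : CellRel u v) : mk u = mk v :=
  congrArg ofPres (RingQuot.mkAlgHom_rel Cq h)

/-- The class of a generator. -/
def gen (s : CellGen) : Cell := mk (FreeAlgebra.ι Cq s)

/-- The homomorphism with given values on the generators. -/
def lift {B : Type*} [Semiring B] [Algebra Cq B] (f : CellGen → B)
    (h : ∀ u v, CellRel u v → FreeAlgebra.lift Cq f u = FreeAlgebra.lift Cq f v) : Cell →ₐ[Cq] B :=
  (RingQuot.liftAlgHom Cq ⟨FreeAlgebra.lift Cq f, fun {u v} => h u v⟩).comp ofPres.symm.toAlgHom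

theorem lift_gen {B : Type*} [Semiring B] [Algebra Cq B] (f : CellGen → B)
    (h : ∀ u v, CellRel u v → FreeAlgebra.lift Cq f u = FreeAlgebra.lift Cq f v) (s : CellGen) :
    lift f h (gen s) = f s := by
  refine Eq.trans ?_ (FreeAlgebra.lift_ι_apply (R := Cq) f s)
  exact RingQuot.liftAlgHom_mkAlgHom_apply Cq (FreeAlgebra.lift Cq f) (fun {u v} => h u v) _

/-- The class of `t_ij`. -/
abbrev tGen (i j : Fin 2) : Cell := gen (.t i j)

/-- The class of `τ̃_5j`. -/
abbrev τGen (j : Fin 2) : Cell := gen (.τ j)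

theorem mk_t (i j : Fin 2) : mk (CellFree.t i j) = tGen i j := rfl

theorem mk_τ (j : Fin 2) : mk (CellFree.τ j) = τGen j := rfl

theorem τ_sq (j : Fin 2) (z : Cell) : τGen j * (τGen j * z) = 0 := by
  have h : τGen j * τGen j = 0 := by
    simpa only [map_mul, map_zero, mk_τ] using mk_rel (.τ_sq j)
  rw [← mul_assoc, h, zero_mul]

theorem t_row (i : Fin 2) (z : Cell) :
    tGen i 0 * (tGen i 1 * z) = q • (tGen i 1 * (tGen i 0 * z)) := by
  have h : tGen i 0 * tGen i 1 = q • (tGen i 1 * tGen i 0) := by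
    simpa only [map_mul, map_smul, mk_t, mk_τ] using mk_rel (.t_row i)
  rw [← mul_assoc, h, smul_mul_assoc, mul_assoc]

theorem t_col (j : Fin 2) (z : Cell) :
    tGen 0 j * (tGen 1 j * z) = qInv • (tGen 1 j * (tGen 0 j * z)) := by
  have h : tGen 0 j * tGen 1 j = qInv • (tGen 1 j * tGen 0 j) := by
    simpa only [map_mul, map_smul, mk_t, mk_τ] using mk_rel (.t_col j)
  rw [← mul_assoc, h, smul_mul_assoc, mul_assoc]

theorem t_comm (z : Cell) : tGen 0 0 * (tGen 1 1 * z) = tGen 1 1 * (tGen 0 0 * z) := by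
  have h : tGen 0 0 * tGen 1 1 = tGen 1 1 * tGen 0 0 := by
    simpa only [map_mul, mk_t, mk_τ] using mk_rel .t_comm
  rw [← mul_assoc, h, mul_assoc]

theorem t_cross (z : Cell) : tGen 0 1 * (tGen 1 0 * z) =
    tGen 1 0 * (tGen 0 1 * z) + (qInv - q) • (tGen 1 1 * (tGen 0 0 * z)) := by
  have h : tGen 0 1 * tGen 1 0 = tGen 1 0 * tGen 0 1 + (qInv - q) • (tGen 1 1 * tGen 0 0) := by
    simpa only [map_mul, map_add, map_smul, mk_t, mk_τ] using mk_rel .t_cross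
  rw [← mul_assoc, h, add_mul, smul_mul_assoc, mul_assoc, mul_assoc]

theorem τ_row (z : Cell) :
    τGen 0 * (τGen 1 * z) = -(qInv • (τGen 1 * (τGen 0 * z))) := by
  have h : τGen 0 * τGen 1 = -(qInv • (τGen 1 * τGen 0)) := by
    simpa only [map_mul, map_neg, map_smul, mk_t, mk_τ] using mk_rel .τ_row
  rw [← mul_assoc, h, neg_mul, smul_mul_assoc, mul_assoc]

theorem tτ_col (i j : Fin 2) (z : Cell) :
    tGen i j * (τGen j * z) = qInv • (τGen j * (tGen i j * z)) := by
  have h : tGen i j * τGen j = qInv • (τGen j * tGen i j) := by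
    simpa only [map_mul, map_smul, mk_t, mk_τ] using mk_rel (.tτ_col i j)
  rw [← mul_assoc, h, smul_mul_assoc, mul_assoc]

theorem tτ_comm (i : Fin 2) (z : Cell) :
    tGen i 0 * (τGen 1 * z) = τGen 1 * (tGen i 0 * z) := by
  have h : tGen i 0 * τGen 1 = τGen 1 * tGen i 0 := by
    simpa only [map_mul, mk_t, mk_τ] using mk_rel (.tτ_comm i)
  rw [← mul_assoc, h, mul_assoc]

theorem tτ_cross (i : Fin 2) (z : Cell) : tGen i 1 * (τGen 0 * z) =
    τGen 0 * (tGen i 1 * z) + (qInv - q) • (τGen 1 * (tGen i 0 * z)) := by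
  have h : tGen i 1 * τGen 0 = τGen 0 * tGen i 1 + (qInv - q) • (tGen i 0 * τGen 1) := by
    simpa only [map_mul, map_add, map_smul, mk_t, mk_τ] using mk_rel (.tτ_cross i)
  rw [← mul_assoc, h, add_mul, smul_mul_assoc, mul_assoc, mul_assoc, tτ_comm]

/-- Two linear maps agree if they agree at `1` and multiplication by generators preserves
the agreement. -/
theorem linearMap_ext {f g : Module.End Cq Cell} (h1 : f 1 = g 1)
    (h : ∀ s u, f u = g u → f (gen s * u) = g (gen s * u)) : f = g := by
  have key (x : CellFree) : ∀ u, f u = g u →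
      f (mk x * u) = g (mk x * u) := by
    induction x using FreeAlgebra.induction with
    | grade0 r => intro u hu; simp [Algebra.algebraMap_eq_smul_one, hu]
    | grade1 s => exact h s
    | mul x y hx hy => intro u hu; simpa [mul_assoc] using hx _ (hy _ hu)
    | add x y hx hy => intro u hu; simp [add_mul, hx u hu, hy u hu]
  ext z
  obtain ⟨x, rfl⟩ := mk_surjective z
  simpa using key x 1 h1

/-- Right commutation of the block `x` with the generators. -/
def rhoXGen : CellGen → Matrix (Fin 2) (Fin 2) Cell
  | .t i 0 => !![qInv • tGen i 0, 0; 0, tGen i 0]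
  | .t i 1 => !![tGen i 1, 0; (qInv - q) • tGen i 0, qInv • tGen i 1]
  | .τ 0 => !![qInv • τGen 0, 0; 0, τGen 0]
  | .τ 1 => !![τGen 1, 0; (qInv - q) • τGen 0, qInv • τGen 1]

/-- Right commutation of the lower right `3 × 3` block with the generators. -/
def rhoYGen : CellGen → Matrix (Fin 3) (Fin 3) Cell
  | .t 0 j => !![q • tGen 0 j, 0, 0; (q - qInv) • tGen 1 j, tGen 0 j, 0;
      (q - qInv) • τGen j, 0, tGen 0 j]
  | .t 1 j => !![tGen 1 j, 0, 0; 0, q • tGen 1 j, 0; 0, (q - qInv) • τGen j, tGen 1 j]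
  | .τ j => !![τGen j, 0, 0; 0, τGen j, 0; 0, 0, -(qInv • τGen j)]

-- This makes the rule `x_lm u = ∑ k, ρ(u)_lk x_km` for moving `x` to the right past the big cell
-- consistent with the defining relations.
set_option maxHeartbeats 2000000 in
theorem rhoXGen_rel {u v : CellFree} (r : CellRel u v) :
    FreeAlgebra.lift Cq rhoXGen u = FreeAlgebra.lift Cq rhoXGen v := by
  have hq := q_mul_qInv
  cases r
  -- The matrices `rhoXGen` are given column by column, so the relations with a free column index
  -- are split first.
  case' τ_sq j => revert j; rw [Fin.forall_fin_two]; constructor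
  case' t_col j => revert j; rw [Fin.forall_fin_two]; constructor
  case' tτ_col i j => revert j; rw [Fin.forall_fin_two]; constructor
  all_goals
    simp only [map_mul, map_add, map_neg, map_smul, map_zero, CellFree.t, CellFree.τ,
      FreeAlgebra.lift_ι_apply, rhoXGen]
    rw [← Matrix.ext_iff, Fin.forall_fin_two, Fin.forall_fin_two, Fin.forall_fin_two]
    refine ⟨⟨?_, ?_⟩, ?_, ?_⟩ <;> refine eq_of_forall_mul_eq fun z => ?_ <;>
    simp [Matrix.mul_apply, mul_assoc, add_mul, t_row, t_col, t_comm, t_cross, τ_sq, τ_row, tτ_col,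
      tτ_comm, tτ_cross, smul_smul, hq]
  all_goals
    match_scalars <;> grind

-- The last diagonal entry at `τ̃_5j` carries the sign of moving the odd `a_53`, `a_54` past an odd
-- generator. It therefore does not give the action of the even `a_55`, which is defined separately
-- as `K₅`.
set_option maxHeartbeats 4000000 in
theorem rhoYGen_rel {u v : CellFree} (r : CellRel u v) :
    FreeAlgebra.lift Cq rhoYGen u = FreeAlgebra.lift Cq rhoYGen v := by
  have hq := q_mul_qInv
  cases r
  case' t_row i => revert i; rw [Fin.forall_fin_two]; constructor
  case' tτ_col i j => revert i; rw [Fin.forall_fin_two]; constructor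
  case' tτ_comm i => revert i; rw [Fin.forall_fin_two]; constructor
  case' tτ_cross i => revert i; rw [Fin.forall_fin_two]; constructor
  all_goals
    simp only [map_mul, map_add, map_neg, map_smul, map_zero, CellFree.t, CellFree.τ,
      FreeAlgebra.lift_ι_apply, rhoYGen]
    ext l m
    refine eq_of_forall_mul_eq fun z => ?_
    fin_cases l <;> fin_cases m <;>
    simp [Matrix.mul_apply, Fin.sum_univ_three, mul_assoc, add_mul, t_row, t_col, t_comm, t_cross,
      τ_sq, τ_row, tτ_col, tτ_comm, tτ_cross, smul_smul, hq]
  all_goals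
    match_scalars <;> grind

/-- Right commutation of the block `x` with the algebra. -/
def rhoX : Cell →ₐ[Cq] Matrix (Fin 2) (Fin 2) Cell := lift rhoXGen fun _ _ r => rhoXGen_rel r

/-- Right commutation of the lower right `3 × 3` block with the algebra. -/
def rhoY : Cell →ₐ[Cq] Matrix (Fin 3) (Fin 3) Cell := lift rhoYGen fun _ _ r => rhoYGen_rel r

/-- The operator given by a matrix coefficient of a matrix valued homomorphism. -/
def coeffOp {n : ℕ} (ρ : Cell →ₐ[Cq] Matrix (Fin n) (Fin n) Cell) (l m : Fin n) :
    Module.End Cq Cell :=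
  (Matrix.entryLinearMap Cq Cell l m).comp ρ.toLinearMap

theorem coeffOp_apply {n : ℕ} (ρ : Cell →ₐ[Cq] Matrix (Fin n) (Fin n) Cell) (l m : Fin n)
    (u : Cell) : coeffOp ρ l m u = ρ u l m := rfl

theorem coeffOp_mul {n : ℕ} (ρ : Cell →ₐ[Cq] Matrix (Fin n) (Fin n) Cell) (l m : Fin n)
    (u v : Cell) : coeffOp ρ l m (u * v) = ∑ k, ρ u l k * coeffOp ρ k m v := by
  simp only [coeffOp_apply, map_mul, Matrix.mul_apply]

/-- The operator by which `a_11` acts. -/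
def K₁ : Module.End Cq Cell := coeffOp rhoX 0 0

/-- The operator by which `a_21` acts. -/
def E₂₁ : Module.End Cq Cell := coeffOp rhoX 1 0

/-- The operator by which `a_22` acts. -/
def K₂ : Module.End Cq Cell := coeffOp rhoX 1 1

/-- The operator by which `a_33` acts. -/
def K₃ : Module.End Cq Cell := coeffOp rhoY 0 0

/-- The operator by which `a_43` acts. -/
def E₄₃ : Module.End Cq Cell := coeffOp rhoY 1 0

/-- The operator by which `a_44` acts. -/
def K₄ : Module.End Cq Cell := coeffOp rhoY 1 1

/-- The operator by which `a_53` acts. -/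
def E₅₃ : Module.End Cq Cell := coeffOp rhoY 2 0

/-- The operator by which `a_54` acts. -/
def E₅₄ : Module.End Cq Cell := coeffOp rhoY 2 1

/-- The operator by which `a_55` acts. -/
def K₅ : Module.End Cq Cell := K₁ * K₂ * K₃ * K₄

@[simp]
theorem op_one : K₁ 1 = 1 ∧ E₂₁ 1 = 0 ∧ K₂ 1 = 1 ∧ K₃ 1 = 1 ∧ E₄₃ 1 = 0 ∧ K₄ 1 = 1 ∧
    E₅₃ 1 = 0 ∧ E₅₄ 1 = 0 := by
  refine ⟨?_, ?_, ?_, ?_, ?_, ?_, ?_, ?_⟩ <;>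
    simp [K₁, E₂₁, K₂, K₃, E₄₃, K₄, E₅₃, E₅₄, coeffOp_apply]

/-- The matrices on generators are lower triangular, hence so are those on all words. This removes
the extra terms in the formulas for `K₂`. -/
theorem coeffOp_rhoX_zero_one : coeffOp rhoX 0 1 = 0 := by
  refine linearMap_ext (by simp [coeffOp_apply]) fun s u h => ?_
  rw [coeffOp_mul, Fin.sum_univ_two, h]
  rcases s with ⟨i, j⟩ | j <;> revert j <;> rw [Fin.forall_fin_two] <;>
    simp [rhoX, lift_gen, rhoXGen]

theorem coeffOp_rhoY_zero_one : coeffOp rhoY 0 1 = 0 := by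
  refine linearMap_ext (by simp [coeffOp_apply]) fun s u h => ?_
  rw [coeffOp_mul, Fin.sum_univ_three, h]
  rcases s with ⟨i, j⟩ | j
  · revert i
    rw [Fin.forall_fin_two]
    simp [rhoY, lift_gen, rhoYGen]
  · simp [rhoY, lift_gen, rhoYGen]

variable (j : Fin 2) (u : Cell)

@[simp]
theorem K₁_apply :
    (∀ i, K₁ (tGen i 0 * u) = qInv • (tGen i 0 * K₁ u)) ∧
    (∀ i, K₁ (tGen i 1 * u) = tGen i 1 * K₁ u) ∧
    K₁ (τGen 0 * u) = qInv • (τGen 0 * K₁ u) ∧ K₁ (τGen 1 * u) = τGen 1 * K₁ u := by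
  simp [K₁, coeffOp_mul, Fin.sum_univ_two, tGen, τGen, rhoX, lift_gen, rhoXGen]

@[simp]
theorem K₂_apply :
    (∀ i, K₂ (tGen i 0 * u) = tGen i 0 * K₂ u) ∧
    (∀ i, K₂ (tGen i 1 * u) = qInv • (tGen i 1 * K₂ u)) ∧
    K₂ (τGen 0 * u) = τGen 0 * K₂ u ∧ K₂ (τGen 1 * u) = qInv • (τGen 1 * K₂ u) := by
  simp only [K₂, coeffOp_mul, Fin.sum_univ_two, coeffOp_rhoX_zero_one]
  simp [tGen, τGen, rhoX, lift_gen, rhoXGen]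

@[simp]
theorem E₂₁_apply :
    (∀ i, E₂₁ (tGen i 0 * u) = tGen i 0 * E₂₁ u) ∧
    (∀ i, E₂₁ (tGen i 1 * u) = (qInv - q) • (tGen i 0 * K₁ u) + qInv • (tGen i 1 * E₂₁ u)) ∧
    E₂₁ (τGen 0 * u) = τGen 0 * E₂₁ u ∧
    E₂₁ (τGen 1 * u) = (qInv - q) • (τGen 0 * K₁ u) + qInv • (τGen 1 * E₂₁ u) := by
  simp [K₁, E₂₁, coeffOp_mul, Fin.sum_univ_two, tGen, τGen, rhoX, lift_gen, rhoXGen]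

@[simp]
theorem K₃_apply : K₃ (tGen 0 j * u) = q • (tGen 0 j * K₃ u) ∧
    K₃ (tGen 1 j * u) = tGen 1 j * K₃ u ∧ K₃ (τGen j * u) = τGen j * K₃ u := by
  simp [K₃, coeffOp_mul, Fin.sum_univ_three, tGen, τGen, rhoY, lift_gen, rhoYGen]

@[simp]
theorem K₄_apply : K₄ (tGen 0 j * u) = tGen 0 j * K₄ u ∧
    K₄ (tGen 1 j * u) = q • (tGen 1 j * K₄ u) ∧ K₄ (τGen j * u) = τGen j * K₄ u := by
  simp only [K₄, coeffOp_mul, Fin.sum_univ_three, coeffOp_rhoY_zero_one]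
  simp [tGen, τGen, rhoY, lift_gen, rhoYGen]

@[simp]
theorem E₄₃_apply :
    E₄₃ (tGen 0 j * u) = (q - qInv) • (tGen 1 j * K₃ u) + tGen 0 j * E₄₃ u ∧
    E₄₃ (tGen 1 j * u) = q • (tGen 1 j * E₄₃ u) ∧ E₄₃ (τGen j * u) = τGen j * E₄₃ u := by
  simp [K₃, E₄₃, coeffOp_mul, Fin.sum_univ_three, tGen, τGen, rhoY, lift_gen, rhoYGen]

@[simp]
theorem E₅₃_apply :
    E₅₃ (tGen 0 j * u) = (q - qInv) • (τGen j * K₃ u) + tGen 0 j * E₅₃ u ∧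
    E₅₃ (tGen 1 j * u) = (q - qInv) • (τGen j * E₄₃ u) + tGen 1 j * E₅₃ u ∧
    E₅₃ (τGen j * u) = -(qInv • (τGen j * E₅₃ u)) := by
  simp [K₃, E₄₃, E₅₃, coeffOp_mul, Fin.sum_univ_three, tGen, τGen, rhoY, lift_gen, rhoYGen]

@[simp]
theorem E₅₄_apply : E₅₄ (tGen 0 j * u) = tGen 0 j * E₅₄ u ∧
    E₅₄ (tGen 1 j * u) = (q - qInv) • (τGen j * K₄ u) + tGen 1 j * E₅₄ u ∧
    E₅₄ (τGen j * u) = -(qInv • (τGen j * E₅₄ u)) := by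
  simp only [K₄, E₅₄, coeffOp_mul, Fin.sum_univ_three, coeffOp_rhoY_zero_one]
  simp [tGen, τGen, rhoY, lift_gen, rhoYGen]

/-- Extensionality of linear maps along the words in the generators. -/
theorem apply_ext {f g : Module.End Cq Cell} (h1 : f 1 = g 1)
    (h : ∀ u, f u = g u →
      f (tGen 0 0 * u) = g (tGen 0 0 * u) ∧ f (tGen 0 1 * u) = g (tGen 0 1 * u) ∧
      f (tGen 1 0 * u) = g (tGen 1 0 * u) ∧ f (tGen 1 1 * u) = g (tGen 1 1 * u) ∧
      f (τGen 0 * u) = g (τGen 0 * u) ∧ f (τGen 1 * u) = g (τGen 1 * u)) (u : Cell) :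
    f u = g u := by
  refine LinearMap.congr_fun (linearMap_ext h1 fun s u hu => ?_) u
  have := h u hu
  rcases s with ⟨i, j⟩ | j <;> revert j
  · revert i
    simp only [Fin.forall_fin_two]
    tauto
  · simp only [Fin.forall_fin_two]
    tauto

/-! ### Commutation relations of the operators -/

-- In this and the following relations both sides agree at `1`, and agreement at `u` passes to a
-- generator times `u`. Oriented as simplification rules, they bring every product to the order
-- `E₂₁`, `E₅₃`, `E₅₄`, `E₄₃`, `K₁`, `K₂`, `K₃`, `K₄`, in which Manin's relations are checked later.
@[simp]
theorem K₂_K₁ : K₂ (K₁ u) = K₁ (K₂ u) := by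
  have hq := q_mul_qInv
  refine apply_ext (f := K₂ * K₁) (g := K₁ * K₂) (by simp) (fun u h => ?_) u
  replace h : K₂ (K₁ u) = K₁ (K₂ u) := h
  refine ⟨?_, ?_, ?_, ?_, ?_, ?_⟩ <;> simp [h, smul_smul, mul_add] <;>
    match_scalars <;> grind

@[simp]
theorem K₃_K₁ : K₃ (K₁ u) = K₁ (K₃ u) := by
  have hq := q_mul_qInv
  refine apply_ext (f := K₃ * K₁) (g := K₁ * K₃) (by simp) (fun u h => ?_) u
  replace h : K₃ (K₁ u) = K₁ (K₃ u) := h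
  refine ⟨?_, ?_, ?_, ?_, ?_, ?_⟩ <;> simp [h, smul_smul, mul_add] <;>
    match_scalars <;> grind

@[simp]
theorem K₃_K₂ : K₃ (K₂ u) = K₂ (K₃ u) := by
  have hq := q_mul_qInv
  refine apply_ext (f := K₃ * K₂) (g := K₂ * K₃) (by simp) (fun u h => ?_) u
  replace h : K₃ (K₂ u) = K₂ (K₃ u) := h
  refine ⟨?_, ?_, ?_, ?_, ?_, ?_⟩ <;> simp [h, smul_smul, mul_add] <;>
    match_scalars <;> grind

@[simp]
theorem K₄_K₁ : K₄ (K₁ u) = K₁ (K₄ u) := by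
  have hq := q_mul_qInv
  refine apply_ext (f := K₄ * K₁) (g := K₁ * K₄) (by simp) (fun u h => ?_) u
  replace h : K₄ (K₁ u) = K₁ (K₄ u) := h
  refine ⟨?_, ?_, ?_, ?_, ?_, ?_⟩ <;> simp [h, smul_smul, mul_add] <;>
    match_scalars <;> grind

@[simp]
theorem K₄_K₂ : K₄ (K₂ u) = K₂ (K₄ u) := by
  have hq := q_mul_qInv
  refine apply_ext (f := K₄ * K₂) (g := K₂ * K₄) (by simp) (fun u h => ?_) u
  replace h : K₄ (K₂ u) = K₂ (K₄ u) := h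
  refine ⟨?_, ?_, ?_, ?_, ?_, ?_⟩ <;> simp [h, smul_smul, mul_add] <;>
    match_scalars <;> grind

@[simp]
theorem K₄_K₃ : K₄ (K₃ u) = K₃ (K₄ u) := by
  have hq := q_mul_qInv
  refine apply_ext (f := K₄ * K₃) (g := K₃ * K₄) (by simp) (fun u h => ?_) u
  replace h : K₄ (K₃ u) = K₃ (K₄ u) := h
  refine ⟨?_, ?_, ?_, ?_, ?_, ?_⟩ <;> simp [h, smul_smul, mul_add] <;>
    match_scalars <;> grind

@[simp]
theorem K₁_E₂₁ : K₁ (E₂₁ u) = qInv • E₂₁ (K₁ u) := by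
  have hq := q_mul_qInv
  refine apply_ext (f := K₁ * E₂₁) (g := qInv • (E₂₁ * K₁)) (by simp) (fun u h => ?_) u
  replace h : K₁ (E₂₁ u) = qInv • E₂₁ (K₁ u) := h
  refine ⟨?_, ?_, ?_, ?_, ?_, ?_⟩ <;> simp [h, smul_smul, mul_add] <;>
    match_scalars <;> grind

@[simp]
theorem K₂_E₂₁ : K₂ (E₂₁ u) = q • E₂₁ (K₂ u) := by
  have hq := q_mul_qInv
  refine apply_ext (f := K₂ * E₂₁) (g := q • (E₂₁ * K₂)) (by simp) (fun u h => ?_) u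
  replace h : K₂ (E₂₁ u) = q • E₂₁ (K₂ u) := h
  refine ⟨?_, ?_, ?_, ?_, ?_, ?_⟩ <;> simp [h, smul_smul, mul_add] <;>
    match_scalars <;> grind

@[simp]
theorem K₃_E₂₁ : K₃ (E₂₁ u) = E₂₁ (K₃ u) := by
  have hq := q_mul_qInv
  refine apply_ext (f := K₃ * E₂₁) (g := E₂₁ * K₃) (by simp) (fun u h => ?_) u
  replace h : K₃ (E₂₁ u) = E₂₁ (K₃ u) := h
  refine ⟨?_, ?_, ?_, ?_, ?_, ?_⟩ <;> simp [h, smul_smul, mul_add] <;>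
    match_scalars <;> grind

@[simp]
theorem K₄_E₂₁ : K₄ (E₂₁ u) = E₂₁ (K₄ u) := by
  have hq := q_mul_qInv
  refine apply_ext (f := K₄ * E₂₁) (g := E₂₁ * K₄) (by simp) (fun u h => ?_) u
  replace h : K₄ (E₂₁ u) = E₂₁ (K₄ u) := h
  refine ⟨?_, ?_, ?_, ?_, ?_, ?_⟩ <;> simp [h, smul_smul, mul_add] <;>
    match_scalars <;> grind

@[simp]
theorem K₁_E₄₃ : K₁ (E₄₃ u) = E₄₃ (K₁ u) := by
  have hq := q_mul_qInv
  refine apply_ext (f := K₁ * E₄₃) (g := E₄₃ * K₁) (by simp) (fun u h => ?_) u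
  replace h : K₁ (E₄₃ u) = E₄₃ (K₁ u) := h
  refine ⟨?_, ?_, ?_, ?_, ?_, ?_⟩ <;> simp [h, smul_smul, mul_add] <;>
    match_scalars <;> grind

@[simp]
theorem K₂_E₄₃ : K₂ (E₄₃ u) = E₄₃ (K₂ u) := by
  have hq := q_mul_qInv
  refine apply_ext (f := K₂ * E₄₃) (g := E₄₃ * K₂) (by simp) (fun u h => ?_) u
  replace h : K₂ (E₄₃ u) = E₄₃ (K₂ u) := h
  refine ⟨?_, ?_, ?_, ?_, ?_, ?_⟩ <;> simp [h, smul_smul, mul_add] <;>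
    match_scalars <;> grind

@[simp]
theorem K₃_E₄₃ : K₃ (E₄₃ u) = qInv • E₄₃ (K₃ u) := by
  have hq := q_mul_qInv
  refine apply_ext (f := K₃ * E₄₃) (g := qInv • (E₄₃ * K₃)) (by simp) (fun u h => ?_) u
  replace h : K₃ (E₄₃ u) = qInv • E₄₃ (K₃ u) := h
  refine ⟨?_, ?_, ?_, ?_, ?_, ?_⟩ <;> simp [h, smul_smul, mul_add] <;>
    match_scalars <;> grind

@[simp]
theorem K₄_E₄₃ : K₄ (E₄₃ u) = q • E₄₃ (K₄ u) := by
  have hq := q_mul_qInv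
  refine apply_ext (f := K₄ * E₄₃) (g := q • (E₄₃ * K₄)) (by simp) (fun u h => ?_) u
  replace h : K₄ (E₄₃ u) = q • E₄₃ (K₄ u) := h
  refine ⟨?_, ?_, ?_, ?_, ?_, ?_⟩ <;> simp [h, smul_smul, mul_add] <;>
    match_scalars <;> grind

@[simp]
theorem K₁_E₅₃ : K₁ (E₅₃ u) = E₅₃ (K₁ u) := by
  have hq := q_mul_qInv
  refine apply_ext (f := K₁ * E₅₃) (g := E₅₃ * K₁) (by simp) (fun u h => ?_) u
  replace h : K₁ (E₅₃ u) = E₅₃ (K₁ u) := h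
  refine ⟨?_, ?_, ?_, ?_, ?_, ?_⟩ <;> simp [h, smul_smul, mul_add] <;>
    match_scalars <;> grind

@[simp]
theorem K₂_E₅₃ : K₂ (E₅₃ u) = E₅₃ (K₂ u) := by
  have hq := q_mul_qInv
  refine apply_ext (f := K₂ * E₅₃) (g := E₅₃ * K₂) (by simp) (fun u h => ?_) u
  replace h : K₂ (E₅₃ u) = E₅₃ (K₂ u) := h
  refine ⟨?_, ?_, ?_, ?_, ?_, ?_⟩ <;> simp [h, smul_smul, mul_add] <;>
    match_scalars <;> grind

@[simp]
theorem K₃_E₅₃ : K₃ (E₅₃ u) = qInv • E₅₃ (K₃ u) := by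
  have hq := q_mul_qInv
  refine apply_ext (f := K₃ * E₅₃) (g := qInv • (E₅₃ * K₃)) (by simp) (fun u h => ?_) u
  replace h : K₃ (E₅₃ u) = qInv • E₅₃ (K₃ u) := h
  refine ⟨?_, ?_, ?_, ?_, ?_, ?_⟩ <;> simp [h, smul_smul, mul_add] <;>
    match_scalars <;> grind

@[simp]
theorem K₄_E₅₃ : K₄ (E₅₃ u) = E₅₃ (K₄ u) := by
  have hq := q_mul_qInv
  refine apply_ext (f := K₄ * E₅₃) (g := E₅₃ * K₄) (by simp) (fun u h => ?_) u
  replace h : K₄ (E₅₃ u) = E₅₃ (K₄ u) := h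
  refine ⟨?_, ?_, ?_, ?_, ?_, ?_⟩ <;> simp [h, smul_smul, mul_add] <;>
    match_scalars <;> grind

@[simp]
theorem K₁_E₅₄ : K₁ (E₅₄ u) = E₅₄ (K₁ u) := by
  have hq := q_mul_qInv
  refine apply_ext (f := K₁ * E₅₄) (g := E₅₄ * K₁) (by simp) (fun u h => ?_) u
  replace h : K₁ (E₅₄ u) = E₅₄ (K₁ u) := h
  refine ⟨?_, ?_, ?_, ?_, ?_, ?_⟩ <;> simp [h, smul_smul, mul_add] <;>
    match_scalars <;> grind

@[simp]
theorem K₂_E₅₄ : K₂ (E₅₄ u) = E₅₄ (K₂ u) := by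
  have hq := q_mul_qInv
  refine apply_ext (f := K₂ * E₅₄) (g := E₅₄ * K₂) (by simp) (fun u h => ?_) u
  replace h : K₂ (E₅₄ u) = E₅₄ (K₂ u) := h
  refine ⟨?_, ?_, ?_, ?_, ?_, ?_⟩ <;> simp [h, smul_smul, mul_add] <;>
    match_scalars <;> grind

@[simp]
theorem K₃_E₅₄ : K₃ (E₅₄ u) = E₅₄ (K₃ u) := by
  have hq := q_mul_qInv
  refine apply_ext (f := K₃ * E₅₄) (g := E₅₄ * K₃) (by simp) (fun u h => ?_) u
  replace h : K₃ (E₅₄ u) = E₅₄ (K₃ u) := h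
  refine ⟨?_, ?_, ?_, ?_, ?_, ?_⟩ <;> simp [h, smul_smul, mul_add] <;>
    match_scalars <;> grind

@[simp]
theorem K₄_E₅₄ : K₄ (E₅₄ u) = qInv • E₅₄ (K₄ u) := by
  have hq := q_mul_qInv
  refine apply_ext (f := K₄ * E₅₄) (g := qInv • (E₅₄ * K₄)) (by simp) (fun u h => ?_) u
  replace h : K₄ (E₅₄ u) = qInv • E₅₄ (K₄ u) := h
  refine ⟨?_, ?_, ?_, ?_, ?_, ?_⟩ <;> simp [h, smul_smul, mul_add] <;>
    match_scalars <;> grind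

@[simp]
theorem E₄₃_E₂₁ : E₄₃ (E₂₁ u) = E₂₁ (E₄₃ u) := by
  have hq := q_mul_qInv
  refine apply_ext (f := E₄₃ * E₂₁) (g := E₂₁ * E₄₃) (by simp) (fun u h => ?_) u
  replace h : E₄₃ (E₂₁ u) = E₂₁ (E₄₃ u) := h
  refine ⟨?_, ?_, ?_, ?_, ?_, ?_⟩ <;> simp [h, smul_smul, mul_add] <;>
    match_scalars <;> grind

@[simp]
theorem E₅₃_E₂₁ : E₅₃ (E₂₁ u) = E₂₁ (E₅₃ u) := by
  have hq := q_mul_qInv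
  refine apply_ext (f := E₅₃ * E₂₁) (g := E₂₁ * E₅₃) (by simp) (fun u h => ?_) u
  replace h : E₅₃ (E₂₁ u) = E₂₁ (E₅₃ u) := h
  refine ⟨?_, ?_, ?_, ?_, ?_, ?_⟩ <;> simp [h, smul_smul, mul_add] <;>
    match_scalars <;> grind

@[simp]
theorem E₅₄_E₂₁ : E₅₄ (E₂₁ u) = E₂₁ (E₅₄ u) := by
  have hq := q_mul_qInv
  refine apply_ext (f := E₅₄ * E₂₁) (g := E₂₁ * E₅₄) (by simp) (fun u h => ?_) u
  replace h : E₅₄ (E₂₁ u) = E₂₁ (E₅₄ u) := h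
  refine ⟨?_, ?_, ?_, ?_, ?_, ?_⟩ <;> simp [h, smul_smul, mul_add] <;>
    match_scalars <;> grind

@[simp]
theorem E₄₃_E₅₃ : E₄₃ (E₅₃ u) = qInv • E₅₃ (E₄₃ u) := by
  have hq := q_mul_qInv
  refine apply_ext (f := E₄₃ * E₅₃) (g := qInv • (E₅₃ * E₄₃)) (by simp) (fun u h => ?_) u
  replace h : E₄₃ (E₅₃ u) = qInv • E₅₃ (E₄₃ u) := h
  refine ⟨?_, ?_, ?_, ?_, ?_, ?_⟩ <;> simp [h, smul_smul, mul_add] <;>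
    match_scalars <;> grind

@[simp]
theorem E₄₃_E₅₄ : E₄₃ (E₅₄ u) = E₅₄ (E₄₃ u) + (qInv - q) • E₅₃ (K₄ u) := by
  have hq := q_mul_qInv
  refine apply_ext (f := E₄₃ * E₅₄) (g := E₅₄ * E₄₃ + (qInv - q) • (E₅₃ * K₄)) (by simp) (fun u h => ?_) u
  replace h : E₄₃ (E₅₄ u) = E₅₄ (E₄₃ u) + (qInv - q) • E₅₃ (K₄ u) := h
  refine ⟨?_, ?_, ?_, ?_, ?_, ?_⟩ <;> simp [h, smul_smul, mul_add] <;>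
    match_scalars <;> grind

@[simp]
theorem E₅₄_E₅₃ : E₅₄ (E₅₃ u) = -(qInv • E₅₃ (E₅₄ u)) := by
  have hq := q_mul_qInv
  refine apply_ext (f := E₅₄ * E₅₃) (g := -(qInv • (E₅₃ * E₅₄))) (by simp) (fun u h => ?_) u
  replace h : E₅₄ (E₅₃ u) = -(qInv • E₅₃ (E₅₄ u)) := h
  refine ⟨?_, ?_, ?_, ?_, ?_, ?_⟩ <;> simp [h, smul_smul, mul_add] <;>
    match_scalars <;> grind

@[simp]
theorem E₅₃_E₅₃ : E₅₃ (E₅₃ u) = 0 := by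
  have hq := q_mul_qInv
  refine apply_ext (f := E₅₃ * E₅₃) (g := 0) (by simp) (fun u h => ?_) u
  replace h : E₅₃ (E₅₃ u) = 0 := h
  refine ⟨?_, ?_, ?_, ?_, ?_, ?_⟩ <;> simp [h, smul_smul, mul_add] <;>
    match_scalars <;> grind

@[simp]
theorem E₅₄_E₅₄ : E₅₄ (E₅₄ u) = 0 := by
  have hq := q_mul_qInv
  refine apply_ext (f := E₅₄ * E₅₄) (g := 0) (by simp) (fun u h => ?_) u
  replace h : E₅₄ (E₅₄ u) = 0 := h
  refine ⟨?_, ?_, ?_, ?_, ?_, ?_⟩ <;> simp [h, smul_smul, mul_add] <;>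
    match_scalars <;> grind

@[simp]
theorem K₅_apply (u : Cell) : K₅ u = K₁ (K₂ (K₃ (K₄ u))) := rfl

/-- The operators by which the entries `a_i1`, `a_i2` act, for a row `(r 0, r 1)` of the big
cell. -/
def rowOp (r : Fin 2 → Cell) : Fin 2 → Module.End Cq Cell :=
  ![LinearMap.mulLeft Cq (r 0) * K₁ + LinearMap.mulLeft Cq (r 1) * E₂₁,
    LinearMap.mulLeft Cq (r 1) * K₂]

/-- The operators by which the matrix entries act on the presented algebra. -/
def op : Fin 5 → Fin 5 → Module.End Cq Cell :=
  ![![K₁, 0, 0, 0, 0],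
    ![E₂₁, K₂, 0, 0, 0],
    ![rowOp (tGen 0) 0, rowOp (tGen 0) 1, K₃, 0, 0],
    ![rowOp (tGen 1) 0, rowOp (tGen 1) 1, E₄₃, K₄, 0],
    ![rowOp τGen 0, rowOp τGen 1, E₅₃, E₅₄, K₅]]

theorem op_eq_zero {i j : Fin 5} (h : i < j) : op i j = 0 := by
  fin_cases i <;> fin_cases j <;> first | rfl | exact absurd h (by decide)

theorem one_add_one : (1 + 1 : ZMod 2) = 0 := rfl

/-- The bound `l ≤ i` keeps only entries on or below the diagonal; otherwise both sides vanish. The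
same holds for the bounds in the three checks after this one. -/
theorem op_row_of_le (i j l : Fin 5) (h : j < l) (h' : l ≤ i) : op i j * op i l =
    (koszul (entryParity i j) (entryParity i l) * qPow (p i)) • (op i l * op i j) := by
  have hq := q_mul_qInv
  fin_cases i <;> fin_cases j <;> fin_cases l <;>
    first
    | exact absurd h (by decide)
    | exact absurd h' (by decide)
    | refine LinearMap.ext fun u => ?_
      simp [op, rowOp, p, entryParity, qPow_zero, qPow_one, koszul_zero_left, koszul_zero_right,
        koszul_one_one, one_add_one, t_row, t_col, t_comm, t_cross, τ_sq, τ_row, tτ_col, tτ_comm,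
        tτ_cross, smul_smul, mul_add] <;> match_scalars <;> grind

theorem op_col_of_le (i j k : Fin 5) (h : i < k) (h' : j ≤ i) : op i j * op k j =
    (koszul (entryParity i j) (entryParity k j) * qPow (p j)) • (op k j * op i j) := by
  have hq := q_mul_qInv
  fin_cases i <;> fin_cases k <;> fin_cases j <;>
    first
    | exact absurd h (by decide)
    | exact absurd h' (by decide)
    | refine LinearMap.ext fun u => ?_
      simp [op, rowOp, p, entryParity, qPow_zero, qPow_one, koszul_zero_left, koszul_zero_right,
        koszul_one_one, one_add_one, t_row, t_col, t_comm, t_cross, τ_sq, τ_row, tτ_col, tτ_comm,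
        tτ_cross, smul_smul, mul_add] <;> match_scalars <;> grind

theorem op_anti_of_le (i j k l : Fin 5) (h : i < k) (h' : l < j) (h'' : j ≤ i) :
    op i j * op k l = op k l * op i j := by
  have hq := q_mul_qInv
  fin_cases i <;> fin_cases k <;> try exact absurd h (by decide)
  all_goals
  fin_cases j <;> try exact absurd h'' (by decide)
  all_goals
  fin_cases l <;>
    first
    | exact absurd h (by decide)
    | exact absurd h' (by decide)
    | exact absurd h'' (by decide)
    | refine LinearMap.ext fun u => ?_
      simp [op, rowOp, p, entryParity, qPow_zero, qPow_one, koszul_zero_left, koszul_zero_right,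
        koszul_one_one, one_add_one, t_row, t_col, t_comm, t_cross, τ_sq, τ_row, tτ_col, tτ_comm,
        tτ_cross, smul_smul, mul_add] <;> match_scalars <;> grind

theorem op_diag_of_le (i j k l : Fin 5) (h : i < k) (h' : j < l) (h'' : j ≤ i) (h₃ : l ≤ k) :
    op i j * op k l = op k l * op i j + (qInv - q) • (op k j * op i l) := by
  have hq := q_mul_qInv
  fin_cases i <;> fin_cases k <;> try exact absurd h (by decide)
  all_goals
  fin_cases j <;> try exact absurd h'' (by decide)
  all_goals
  fin_cases l <;>
    first
    | exact absurd h (by decide)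
    | exact absurd h' (by decide)
    | exact absurd h'' (by decide)
    | exact absurd h₃ (by decide)
    | refine LinearMap.ext fun u => ?_
      simp [op, rowOp, p, entryParity, qPow_zero, qPow_one, koszul_zero_left, koszul_zero_right,
        koszul_one_one, one_add_one, t_row, t_col, t_comm, t_cross, τ_sq, τ_row, tτ_col, tτ_comm,
        tτ_cross, smul_smul, mul_add] <;> match_scalars <;> grind

end Cell

/-! ### Quantum determinants of triangular matrices -/

theorem map_qDet {A B : Type*} [Semiring A] [Algebra Cq A] [Semiring B] [Algebra Cq B]
    (f : A →ₐ[Cq] B) {n : ℕ} (b : Fin n → Fin n → A) :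
    f (qDet b) = qDet fun i j => f (b i j) := by
  simp [qDet, map_list_prod, List.map_ofFn, Function.comp_def]

/-- If `σ i ≤ i` throughout, then strong induction and injectivity give `σ i = i`. So a nonidentity
permutation always meets an entry above the diagonal. -/
theorem exists_lt_apply {n : ℕ} {σ : Equiv.Perm (Fin n)} (h : σ ≠ 1) : ∃ i, i < σ i := by
  by_contra! hσ
  refine h (Equiv.ext fun i => ?_)
  induction i using WellFoundedLT.induction with
  | ind i ih =>
    refine (hσ i).eq_or_lt.resolve_right fun hi => ?_
    exact hi.ne (σ.injective (ih _ hi))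

theorem qDet_of_lowerTriangular {A : Type*} [Semiring A] [Algebra Cq A] {n : ℕ}
    {b : Fin n → Fin n → A} (h : ∀ i j, i < j → b i j = 0) :
    qDet b = (List.ofFn fun i => b i i).prod := by
  rw [qDet, Finset.sum_eq_single 1]
  · have : permLength (1 : Equiv.Perm (Fin n)) = 0 := by
      rw [permLength, Finset.card_eq_zero, Finset.filter_eq_empty_iff]
      rintro ⟨i, j⟩ - ⟨hij, hji⟩
      exact lt_asymm hij hji
    rw [this, pow_zero, one_smul]
    rfl
  · intro σ _ hσ
    obtain ⟨i, hi⟩ := exists_lt_apply hσ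
    have h0 : (List.ofFn fun i => b i (σ i)).prod = 0 :=
      List.prod_eq_zero (List.mem_ofFn.2 ⟨i, (h i (σ i) hi : b i (σ i) = 0)⟩)
    rw [h0, smul_zero]
  · exact fun h => absurd (Finset.mem_univ _) h

/-! ### The action of the quantum parabolic on the presented algebra -/

namespace Cell

/-- The values on generators of the inverse of `K₅`. -/
def kInvGen : CellGen → Cell
  | .t i j => tGen i j
  | .τ j => q • τGen j

/-- The relations are homogeneous in the number of factors `τ̃`, so rescaling the odd generators
respects them. `K₅` fixes each `t_ij` and scales each `τ̃_5j` by `qInv`, which explains the values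
of `kInvGen`. -/
theorem kInvGen_rel {u v : CellFree} (r : CellRel u v) :
    FreeAlgebra.lift Cq kInvGen u = FreeAlgebra.lift Cq kInvGen v := by
  refine eq_of_forall_mul_eq fun z => ?_
  cases r <;>
    simp [CellFree.t, CellFree.τ, kInvGen, mul_assoc, add_mul, t_row, t_col, t_comm, t_cross, τ_sq,
      τ_row, tτ_col, tτ_comm, tτ_cross, smul_smul] <;>
    match_scalars <;> ring

/-- The inverse of `K₅`. -/
def kInv : Module.End Cq Cell := (lift kInvGen fun _ _ r => kInvGen_rel r).toLinearMap

@[simp]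
theorem kInv_one : kInv 1 = 1 := map_one (lift kInvGen fun _ _ r => kInvGen_rel r)

@[simp]
theorem kInv_apply (u : Cell) : (∀ i j, kInv (tGen i j * u) = tGen i j * kInv u) ∧
    ∀ j, kInv (τGen j * u) = q • (τGen j * kInv u) := by
  simp [kInv, tGen, τGen, lift_gen, kInvGen]

theorem K₅_mul_kInv : K₅ * kInv = 1 := by
  have hq := q_mul_qInv
  refine LinearMap.ext (apply_ext (by simp) fun u h => ?_)
  replace h : K₁ (K₂ (K₃ (K₄ (kInv u)))) = u := h
  refine ⟨?_, ?_, ?_, ?_, ?_, ?_⟩ <;> simp [h, smul_smul] <;> match_scalars <;> grind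

theorem kInv_mul_K₅ : kInv * K₅ = 1 := by
  have hq := q_mul_qInv
  refine LinearMap.ext (apply_ext (by simp) fun u h => ?_)
  replace h : kInv (K₁ (K₂ (K₃ (K₄ u)))) = u := h
  refine ⟨?_, ?_, ?_, ?_, ?_, ?_⟩ <;> simp [h, smul_smul] <;> match_scalars <;> grind

theorem op_row (i j l : Fin 5) (h : j < l) : op i j * op i l =
    (koszul (entryParity i j) (entryParity i l) * qPow (p i)) • (op i l * op i j) := by
  by_cases h' : l ≤ i
  · exact op_row_of_le i j l h h'
  · rw [op_eq_zero (not_le.1 h'), mul_zero, zero_mul, smul_zero]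

theorem op_col (i j k : Fin 5) (h : i < k) : op i j * op k j =
    (koszul (entryParity i j) (entryParity k j) * qPow (p j)) • (op k j * op i j) := by
  by_cases h' : j ≤ i
  · exact op_col_of_le i j k h h'
  · rw [op_eq_zero (not_le.1 h'), mul_zero, zero_mul, smul_zero]

theorem ne_four_of_lt {i k : Fin 5} (h : i < k) : i ≠ 4 := (h.trans_le (Fin.le_last k)).ne

theorem op_anti (i j k l : Fin 5) (h : (i < k ∧ l < j) ∨ (k < i ∧ j < l)) :
    op i j * op k l = koszul (entryParity i j) (entryParity k l) • (op k l * op i j) := by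
  rcases h with ⟨h, h'⟩ | ⟨h, h'⟩
  · by_cases hj : j ≤ i
    · rw [entryParity_of_ne (ne_four_of_lt h) (ne_four_of_lt (hj.trans_lt h)), koszul_zero_left,
        one_smul, op_anti_of_le i j k l h h' hj]
    · rw [op_eq_zero (not_le.1 hj), mul_zero, zero_mul, smul_zero]
  · by_cases hl : l ≤ k
    · rw [entryParity_of_ne (ne_four_of_lt h) (ne_four_of_lt (hl.trans_lt h)), koszul_zero_right,
        one_smul, op_anti_of_le k l i j h h' hl]
    · rw [op_eq_zero (not_le.1 hl), mul_zero, zero_mul, smul_zero]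

theorem op_diag (i j k l : Fin 5) (h : i < k) (h' : j < l) :
    op i j * op k l - koszul (entryParity i j) (entryParity k l) • (op k l * op i j) =
      (koszul (entryParity i j) (entryParity k j) * (qInv - q)) • (op k j * op i l) := by
  rw [entryParity_of_ne (ne_four_of_lt h) (ne_four_of_lt h'), koszul_zero_left, koszul_zero_left,
    one_smul, one_mul, sub_eq_iff_eq_add']
  by_cases hj : j ≤ i
  · by_cases hl : l ≤ k
    · exact op_diag_of_le i j k l h h' hj hl
    · rw [op_eq_zero (not_le.1 hl), op_eq_zero (h.trans (not_le.1 hl))]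
      simp
  · rw [op_eq_zero (not_le.1 hj), op_eq_zero ((not_le.1 hj).trans h')]
    simp

theorem op_sq (i j : Fin 5) (h : entryParity i j = 1) : op i j * op i j = 0 := by
  have hq := q_mul_qInv
  by_cases hij : i < j
  · rw [op_eq_zero hij, mul_zero]
  fin_cases i <;> fin_cases j <;>
    first
    | exact absurd h (by decide)
    | exact absurd (by decide) hij
    | refine LinearMap.ext fun u => ?_
      simp [op, rowOp, τ_sq, τ_row, smul_smul, mul_add] <;> match_scalars <;> grind

/-- The operators by which the generators act on the presented algebra. -/
def opGen : SLGen → Module.End Cq Cell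
  | .a i j => op i j
  | .D₁inv => kInv
  | .D₂inv => kInv

/-- Since `a_i5` acts by zero for `i ≤ 4`, the relation `Ber_q = 1` says that `D₁` and `D₂` act
equally. This is why `a_55` acts by `K₅` and both inverses by `kInv`. -/
theorem qDet_op : qDet (fun i j : Fin 4 => op i.castSucc j.castSucc) = K₅ := by
  rw [qDet_of_lowerTriangular (b := fun i j : Fin 4 => op i.castSucc j.castSucc)
    fun i j h => op_eq_zero h]
  simp [List.ofFn_succ, op, K₅, mul_assoc]

theorem lift_opGen_a (i j : Fin 5) : FreeAlgebra.lift Cq opGen (SLFree.a i j) = op i j :=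
  FreeAlgebra.lift_ι_apply _ _

theorem lift_opGen_D₁inv : FreeAlgebra.lift Cq opGen SLFree.D₁inv = kInv :=
  FreeAlgebra.lift_ι_apply _ _

theorem lift_opGen_D₂inv : FreeAlgebra.lift Cq opGen SLFree.D₂inv = kInv :=
  FreeAlgebra.lift_ι_apply _ _

theorem lift_opGen_D₁ : FreeAlgebra.lift Cq opGen SLFree.D₁ = K₅ := by
  simp only [SLFree.D₁, map_qDet, lift_opGen_a, qDet_op]

theorem lift_opGen_D₂ : FreeAlgebra.lift Cq opGen SLFree.D₂ = K₅ := lift_opGen_a 4 4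

theorem lift_opGen_ber : FreeAlgebra.lift Cq opGen SLFree.ber = 1 := by
  have h (i : Fin 4) : op i.castSucc 4 = 0 := op_eq_zero i.castSucc_lt_last
  simp only [SLFree.ber, map_mul, map_qDet, map_sub, lift_opGen_a, lift_opGen_D₂inv, h, zero_mul,
    sub_zero, qDet_op, K₅_mul_kInv]

theorem opGen_rel {u v : SLFree} (r : SLRel u v) :
    FreeAlgebra.lift Cq opGen u = FreeAlgebra.lift Cq opGen v := by
  cases r <;> simp only [map_mul, map_sub, map_smul, map_zero, map_one, lift_opGen_a,
    lift_opGen_D₁inv, lift_opGen_D₂inv, lift_opGen_D₁, lift_opGen_D₂, lift_opGen_ber, K₅_mul_kInv,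
    kInv_mul_K₅]
  case odd_sq i j h => exact op_sq i j h
  case row i j l h => exact op_row i j l h
  case col i j k h => exact op_col i j k h
  case anti i j k l h => exact op_anti i j k l h
  case diag i j k l h h' => exact op_diag i j k l h h'

/-- The action of `O(SL_q(4|1))` on the presented algebra. -/
def slAction : SLq →ₐ[Cq] Module.End Cq Cell :=
  RingQuot.liftAlgHom Cq ⟨FreeAlgebra.lift Cq opGen, fun {_ _} r => opGen_rel r⟩

theorem slAction_gen (s : SLGen) : slAction (SLq.gen s) = opGen s := by
  simp [slAction, SLq.gen]

/-- The action of `O(P_{l,q})` on the presented algebra. -/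
def action : OPlq →ₐ[Cq] Module.End Cq Cell :=
  RingQuot.liftAlgHom Cq ⟨slAction, by
    rintro _ _ ⟨i, j, hi, hj⟩
    rw [slAction_gen, map_zero]
    exact op_eq_zero (hi.trans_le hj)⟩

theorem action_gen (s : SLGen) : action (OPlq.gen s) = opGen s := by
  rw [action, OPlq.gen, RingQuot.liftAlgHom_mkAlgHom_apply, slAction_gen]

/-! ### Injectivity -/

theorem K₁_mul_cancel {f g : Module.End Cq Cell} (h : f * K₁ = g * K₁) : f = g := by
  have hK : K₁ * (K₂ * K₃ * K₄ * kInv) = 1 := by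
    rw [← K₅_mul_kInv, K₅]
    simp only [mul_assoc]
  simp only [mul_assoc] at hK
  simpa only [mul_assoc, hK, mul_one] using congrArg (· * (K₂ * K₃ * K₄ * kInv)) h

theorem K₂_mul_cancel {f g : Module.End Cq Cell} (h : f * K₂ = g * K₂) : f = g := by
  have hK : K₂ * (K₁ * K₃ * K₄ * kInv) = 1 := by
    have : K₂ * K₁ = K₁ * K₂ := LinearMap.ext fun u => K₂_K₁ u
    rw [← K₅_mul_kInv, K₅, ← this]
    simp only [mul_assoc]
  simp only [mul_assoc] at hK
  simpa only [mul_assoc, hK, mul_one] using congrArg (· * (K₁ * K₃ * K₄ * kInv)) h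

/-- The block `x` acts by a triangular matrix with invertible diagonal. The second column determines
the action of `b` after cancelling `K₂`; then the `E₂₁` terms of the first column agree, and
cancelling `K₁` determines the action of `a`. -/
theorem action_eq_mulLeft {r : Fin 2 → Cell} {a b e f : OPlq}
    (h0 : a * OPlq.g 0 0 + b * OPlq.g 1 0 = e) (h1 : a * OPlq.g 0 1 + b * OPlq.g 1 1 = f)
    (he : action e = rowOp r 0) (hf : action f = rowOp r 1) :
    action a = LinearMap.mulLeft Cq (r 0) ∧ action b = LinearMap.mulLeft Cq (r 1) := by
  have hb : action b = LinearMap.mulLeft Cq (r 1) := by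
    apply K₂_mul_cancel
    rw [← h1, map_add, map_mul, map_mul] at hf
    simp only [OPlq.g, action_gen] at hf
    simpa [opGen, op, rowOp] using hf
  refine ⟨K₁_mul_cancel ?_, hb⟩
  rw [← h0, map_add, map_mul, map_mul, hb] at he
  simp only [OPlq.g, action_gen] at he
  simpa [opGen, op, rowOp] using he

theorem action_t (i j : Fin 2) : action (OPlq.t i j) = LinearMap.mulLeft Cq (tGen i j) := by
  have h : OPlq.t * OPlq.x = OPlq.tx := by
    rw [OPlq.t, mul_assoc, Ring.inverse_mul_cancel _ OPlq.isUnit_x, mul_one]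
  have h0 := congrFun (congrFun h i) 0
  have h1 := congrFun (congrFun h i) 1
  rw [Matrix.mul_apply, Fin.sum_univ_two] at h0 h1
  have := action_eq_mulLeft (r := tGen i) h0 h1 (by fin_cases i <;> exact action_gen _)
    (by fin_cases i <;> exact action_gen _)
  fin_cases j
  exacts [this.1, this.2]

theorem action_τ (j : Fin 2) : action (OPlq.τ 0 j) = LinearMap.mulLeft Cq (τGen j) := by
  have h : OPlq.τ * OPlq.x = OPlq.τx := by
    rw [OPlq.τ, Matrix.mul_assoc, Ring.inverse_mul_cancel _ OPlq.isUnit_x, Matrix.mul_one]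
  have h0 := congrFun (congrFun h 0) 0
  have h1 := congrFun (congrFun h 0) 1
  rw [Matrix.mul_apply, Fin.sum_univ_two] at h0 h1
  have := action_eq_mulLeft (r := τGen) h0 h1 (action_gen _) (action_gen _)
  fin_cases j
  exacts [this.1, this.2]

theorem action_toOPlq (z : CellPres) : action (CellPres.toOPlq z) 1 = ofPres z := by
  -- Through the homomorphism, the action restricts to the left regular representation.
  have : (action.comp CellPres.toOPlq) = (Algebra.lmul Cq Cell).comp ofPres.toAlgHom := by
    refine RingQuot.ringQuot_ext' _ _ _ (FreeAlgebra.hom_ext (funext fun s => ?_))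
    show action (CellPres.toOPlq (CellPres.gen s)) = LinearMap.mulLeft Cq (gen s)
    rcases s with ⟨i, j⟩ | j
    · rw [CellPres.toOPlq_t, action_t]
    · rw [CellPres.toOPlq_τ, action_τ]
  have h := LinearMap.congr_fun (DFunLike.congr_fun this z) 1
  exact h.trans (mul_one _)

theorem toOPlq_injective : Function.Injective CellPres.toOPlq := fun z w h =>
  ofPres.injective (by rw [← action_toOPlq, h, action_toOPlq])

/-- The subspace of elements of the presented algebra of a given parity. -/
abbrev part (ε : ZMod 2) : Submodule Cq Cell := superPart gen CellGen.parity ε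

/-! ### Homogeneity of the action and reflection of parity -/

theorem tGen_mem (i j : Fin 2) : tGen i j ∈ part 0 :=
  gen_mem_superPart (g := gen) (π := CellGen.parity) (.t i j)

theorem τGen_mem (j : Fin 2) : τGen j ∈ part 1 :=
  gen_mem_superPart (g := gen) (π := CellGen.parity) (.τ j)

/-- Here `d` gives the parities of the matrix indices, so that a homomorphism which is even on
generators for the induced grading of matrices is even on all words. -/
theorem coeffOp_mem {n : ℕ} {ρ : Cell →ₐ[Cq] Matrix (Fin n) (Fin n) Cell} {d : Fin n → ZMod 2}
    (h : ∀ s l m, ρ (gen s) l m ∈ part (s.parity + d l + d m)) {ε : ZMod 2} {u : Cell}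
    (hu : u ∈ part ε) (l m : Fin n) : coeffOp ρ l m u ∈ part (ε + d l + d m) := by
  refine superPart_induction (coeffOp ρ l m) (fun w hw => ?_) hu
  subst hw
  clear hu
  induction w generalizing l with
  | nil =>
    by_cases hlm : l = m
    · subst hlm
      simpa [coeffOp_apply, CharTwo.add_self_eq_zero] using one_mem_superPart
    · simp [coeffOp_apply, Matrix.one_apply_ne hlm]
  | cons s w ih =>
    simp only [List.map_cons, List.prod_cons, List.sum_cons, coeffOp_mul]
    refine sum_mem fun k _ => ?_
    convert mul_mem_superPart (h s l k) (ih k) using 2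
    -- The parity of the summation index enters twice and cancels.
    linear_combination -CharTwo.add_self_eq_zero (d k)

theorem rhoX_mem (s : CellGen) (l m : Fin 2) : rhoX (gen s) l m ∈ part (s.parity + 0 + 0) := by
  rw [rhoX, lift_gen, add_zero, add_zero]
  revert l m
  simp only [Fin.forall_fin_two]
  rcases s with ⟨i, j⟩ | j <;> revert j <;>
    simp [Fin.forall_fin_two, rhoXGen, Submodule.smul_mem, tGen_mem, τGen_mem, CellGen.parity]

theorem rhoY_mem (s : CellGen) (l m : Fin 3) :
    rhoY (gen s) l m ∈ part (s.parity + ![0, 0, 1] l + ![0, 0, 1] m) := by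
  have h : (1 + 1 : ZMod 2) = 0 := rfl
  rw [rhoY, lift_gen]
  rcases s with ⟨i, j⟩ | j
  · revert i
    rw [Fin.forall_fin_two]
    constructor <;> fin_cases l <;> fin_cases m <;>
      simp [rhoYGen, Submodule.smul_mem, tGen_mem, τGen_mem, CellGen.parity, h]
  · fin_cases l <;> fin_cases m <;>
      simp [rhoYGen, Submodule.smul_mem, tGen_mem, τGen_mem, CellGen.parity, h]

/-- The subspace of operators that are homogeneous of a given parity. -/
def opPart (ε : ZMod 2) : Submodule Cq (Module.End Cq Cell) where
  carrier := {f | ∀ δ u, u ∈ part δ → f u ∈ part (δ + ε)}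
  zero_mem' _ _ _ := zero_mem _
  add_mem' hf hg δ u hu := add_mem (hf δ u hu) (hg δ u hu)
  smul_mem' c _ hf δ u hu := Submodule.smul_mem _ c (hf δ u hu)

theorem one_mem_opPart : 1 ∈ opPart 0 := fun δ u hu => by simpa using hu

theorem mul_mem_opPart {f g : Module.End Cq Cell} {ε δ : ZMod 2} (hf : f ∈ opPart ε)
    (hg : g ∈ opPart δ) : f * g ∈ opPart (ε + δ) := fun η u hu => by
  have := hf _ _ (hg η u hu)
  rwa [add_assoc, add_comm δ] at this

theorem mulLeft_mem_opPart (s : CellGen) : LinearMap.mulLeft Cq (gen s) ∈ opPart s.parity :=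
  fun δ u hu => by
    rw [add_comm]
    exact mul_mem_superPart (gen_mem_superPart s) hu

theorem coeffOp_rhoX_mem (l m : Fin 2) : coeffOp rhoX l m ∈ opPart 0 := fun δ u hu => by
  simpa using coeffOp_mem (d := fun _ => 0) rhoX_mem hu l m

theorem coeffOp_rhoY_mem (l m : Fin 3) {ε : ZMod 2} (h : ![0, 0, 1] l + ![0, 0, 1] m = ε) :
    coeffOp rhoY l m ∈ opPart ε := fun δ u hu => by
  have := coeffOp_mem (d := ![0, 0, 1]) rhoY_mem hu l m
  rwa [add_assoc, h] at this

theorem K₅_mem : K₅ ∈ opPart 0 := by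
  have h := mul_mem_opPart (mul_mem_opPart (mul_mem_opPart (coeffOp_rhoX_mem 0 0)
    (coeffOp_rhoX_mem 1 1)) (coeffOp_rhoY_mem 0 0 rfl)) (coeffOp_rhoY_mem 1 1 rfl)
  exact h

theorem kInv_mem : kInv ∈ opPart 0 := fun δ u hu => by
  rw [add_zero]
  refine superPart_induction kInv (fun w hw => ?_) hu
  refine hw ▸ map_list_prod_mem_superPart (lift kInvGen fun _ _ r => kInvGen_rel r)
    (fun s => ?_) w
  rw [lift_gen]
  cases s
  exacts [gen_mem_superPart _, Submodule.smul_mem _ _ (gen_mem_superPart _)]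

theorem rowOp_mem {s : Fin 2 → CellGen} {ε : ZMod 2} (h : ∀ j, (s j).parity = ε) (j : Fin 2) :
    rowOp (fun j => gen (s j)) j ∈ opPart ε := by
  have hm (k : Fin 2) (l m : Fin 2) :
      LinearMap.mulLeft Cq (gen (s k)) * coeffOp rhoX l m ∈ opPart ε := by
    simpa [h k] using mul_mem_opPart (mulLeft_mem_opPart (s k)) (coeffOp_rhoX_mem l m)
  fin_cases j
  exacts [add_mem (hm 0 0 0) (hm 1 1 0), hm 1 1 1]

theorem op_mem (i j : Fin 5) : op i j ∈ opPart (entryParity i j) := by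
  by_cases hij : i < j
  · rw [op_eq_zero hij]
    exact zero_mem _
  fin_cases i <;> fin_cases j <;> try exact absurd (by decide) hij
  exacts [coeffOp_rhoX_mem 0 0, coeffOp_rhoX_mem 1 0, coeffOp_rhoX_mem 1 1,
    rowOp_mem (s := .t 0) (fun _ => rfl) 0, rowOp_mem (s := .t 0) (fun _ => rfl) 1,
    coeffOp_rhoY_mem 0 0 rfl,
    rowOp_mem (s := .t 1) (fun _ => rfl) 0, rowOp_mem (s := .t 1) (fun _ => rfl) 1,
    coeffOp_rhoY_mem 1 0 rfl, coeffOp_rhoY_mem 1 1 rfl,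
    rowOp_mem (s := .τ) (fun _ => rfl) 0, rowOp_mem (s := .τ) (fun _ => rfl) 1,
    coeffOp_rhoY_mem 2 0 rfl, coeffOp_rhoY_mem 2 1 rfl, K₅_mem]

theorem opGen_mem (s : SLGen) : opGen s ∈ opPart s.parity := by
  cases s
  exacts [op_mem _ _, kInv_mem, kInv_mem]

theorem action_mem {w : OPlq} {ε : ZMod 2} (hw : w ∈ superPart OPlq.gen SLGen.parity ε) :
    action w ∈ opPart ε := by
  refine superPart_induction action.toLinearMap (fun l hl => ?_) hw
  subst hl
  clear hw
  induction l with
  | nil => simpa using one_mem_opPart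
  | cons s l ih => simpa [action_gen] using mul_mem_opPart (opGen_mem s) ih

/-- The image of `z` acts by an operator of parity `ε`, and this operator sends the even element `1`
to `z`. Directness of the sum of the even and odd parts is not needed. -/
theorem mem_superPart_of_toOPlq_mem {z : CellPres} {ε : ZMod 2}
    (h : CellPres.toOPlq z ∈ superPart OPlq.gen SLGen.parity ε) :
    z ∈ superPart CellPres.gen CellGen.parity ε := by
  have hz := action_mem h 0 1 one_mem_superPart
  rw [action_toOPlq, zero_add] at hz
  have := superPart_induction (N := superPart CellPres.gen CellGen.parity ε)
    ofPres.symm.toLinearMap (fun l hl => hl ▸ map_list_prod_mem_superPart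
      ofPres.symm.toAlgHom (fun s => gen_mem_superPart (g := CellPres.gen) s) l) hz
  exact this

end Cell

/-- The isomorphism between the presented algebra and the quantum big cell. -/
def CellPres.equivBigCell : CellPres ≃ₐ[Cq] bigCell :=
  (AlgEquiv.ofInjective toOPlq Cell.toOPlq_injective).trans
    (Subalgebra.equivOfEq _ _ range_toOPlq)

end QuantumBigCell

end

open QuantumBigCell in
theorem mainTheorem4 :
    -- the block `x` is invertible, so that `t` and `τ̃` are well defined
    IsUnit OPlq.x ∧
    -- the presented superalgebra is isomorphic to the quantum big cell, by the isomorphism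
    -- that sends generators to generators
    ∃ φ : CellPres ≃ₐ[Cq] bigCell,
      (∀ i j : Fin 2, (φ (CellPres.gen (.t i j)) : OPlq) = OPlq.t i j) ∧
      (∀ j : Fin 2, (φ (CellPres.gen (.τ j)) : OPlq) = OPlq.τ 0 j) ∧
      -- the isomorphism respects the parities
      (∀ (ε : ZMod 2) (z : CellPres),
        z ∈ superPart CellPres.gen CellGen.parity ε ↔
          (φ z : OPlq) ∈ superPart OPlq.gen SLGen.parity ε) :=
  ⟨OPlq.isUnit_x, CellPres.equivBigCell, CellPres.toOPlq_t, CellPres.toOPlq_τ, fun _ _ =>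
    ⟨CellPres.toOPlq_mem, Cell.mem_superPart_of_toOPlq_mem⟩⟩
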